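/- Let $n\in\mathbb N$, $1<p<\infty$, $t>0$. Let $V$ be Lebesgue measure on $\mathbb C^n$, let $f_s(z)=(\pi s)^{-n}e^{-|z|^2/s}$ and $d\mu_s=f_s\,dV$ for $s>0$, and let $F_t^p=L^p(\mathbb C^n,\mu_{2t/p})\cap\operatorname{Hol}(\mathbb C^n)$ be the Fock space with the norm of $L^p(\mathbb C^n,\mu_{2t/p})$. Let $\mathcal L(F_t^p)$ be the algebra of bounded operators on $F_t^p$. For $z\in\mathbb C^n$ let $(W_zf)(w)=e^{w\cdot\overline z/t-|z|^2/(2t)}f(w-z)$ and let $\alpha_z(A)=W_zAW_{-z}$ for $A\in\mathcal L(F_t^p)$. Let $$\mathcal C_1=\{A\in\mathcal L(F_t^p):\ z\mapsto\alpha_z(A)\text{ is continuous in operator norm}\}.$$ For a nuclear operator $N=\sum_j y_j\otimes x_j$ with $\sum_j\|y_j\|\|x_j\|<\infty$ and $A\in\mathcal L(F_t^p)$ write $\langle A,N\rangle=\operatorname{Tr}(AN)=\sum_j y_j(Ax_j)$. For $g\in L^1(\mathbb C^n)$ and $A\in\mathcal L(F_t^p)$ the convolution $g*A\in\mathcal L(F_t^p)$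 is the weak$^*$ integral $\int g(z)\,\alpha_z(A)\,dV(z)$, i.e. $\langle g*A,N\rangle=\int g(z)\langle\alpha_z(A),N\rangle\,dV(z)$ for all nuclear $N$. Let $(Uf)(w)=f(-w)$ on $F_t^p$ and $(N*A)(z)=\operatorname{Tr}(N\alpha_z(UAU))$ for nuclear $N$. Let $\mathcal R_t\in\mathcal L(F_t^p)$ be the rank one operator $\mathcal R_tf=(\pi t)^{-n}f(0)$. For a bounded function $f$ the operator $\mathcal R_t*f\in\mathcal L(F_t^p)$ is defined by $\langle\mathcal R_t*f,N\rangle=\int f(z)\,(N*(U\mathcal R_tU))(z)\,dV(z)$ for all nuclear $N$. Let $\operatorname{BUC}(\mathbb C^n)$ be the space of bounded uniformly continuous functions $\mathbb C^n\to\mathbb C$. Then the convolutions $g*A$ ($g\in L^1(\mathbb C^n)$, $A\in\mathcal L(F_t^p)$) and $\mathcal R_t*f$ ($f\in\operatorname{BUC}(\mathbb C^n)$) exist and are uniquely determined, and $$\begin{aligned}\mathcal C_1&=\overline{\operatorname{span}}\{g*B:\ g\in L^1(\mathbb C^n),\ B\in\mathcal L(F_t^p)\}\\&=\{B\in\mathcal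 L(F_t^p):\ f_s*B\to B\text{ in operator norm as }s\to0^+\}\\&=\overline{\{\mathcal R_t*f:\ f\in\operatorname{BUC}(\mathbb C^n)\}}\\&=\{g*B:\ g\in L^1(\mathbb C^n),\ B\in\mathcal C_1\},\end{aligned}$$ where closures are taken in operator norm. Moreover, for $f\in\operatorname{BUC}(\mathbb C^n)$ the operator $\mathcal R_t*f$ is the Toeplitz operator with symbol $f$: $((\mathcal R_t*f)h)(w)=\int e^{w\cdot\overline z/t}f(z)h(z)\,d\mu_t(z)$ for all $h\in F_t^p$ and $w\in\mathbb C^n$, the integral being absolutely convergent. -/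

import Mathlib

open MeasureTheory Filter Topology
open scoped ENNReal

noncomputable section

namespace PFock

/-- The Hermitian dot product `w · z̄ = ∑ i, w i * conj (z i)` on `ℂⁿ`. -/
def hdot {n : ℕ} (w z : Fin n → ℂ) : ℂ := ∑ i, w i * (starRingEnd ℂ) (z i)

/-- The squared Euclidean norm `|z|²` on `ℂⁿ`. -/
def sqNorm {n : ℕ} (z : Fin n → ℂ) : ℝ := ∑ i, ‖z i‖ ^ 2

/-- The Gaussian `f_s(z) = (π s)⁻ⁿ exp (-|z|² / s)` on `ℂⁿ`. -/
def gauss (n : ℕ) (s : ℝ) (z : Fin n → ℂ) : ℝ :=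
  1 / (Real.pi * s) ^ n * Real.exp (-sqNorm z / s)

/-- The Gaussian measure `dμ_s = f_s dV`, where `V` is the Lebesgue measure of `ℂⁿ`. -/
def gaussMeasure (n : ℕ) (s : ℝ) : Measure (Fin n → ℂ) :=
  (volume : Measure (Fin n → ℂ)).withDensity (fun z => ENNReal.ofReal (gauss n s z))

/-- The normalized reproducing kernel `k_z(w) = exp (w · z̄ / t - |z|² / (2 t))`. -/
def nkernel {n : ℕ} (t : ℝ) (z w : Fin n → ℂ) : ℂ :=
  Complex.exp (hdot w z / (t : ℂ) - ((sqNorm z / (2 * t) : ℝ) : ℂ))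

/-! ### Facts on Gaussian measures -/

theorem continuous_sqNorm {n : ℕ} : Continuous (sqNorm (n := n)) := by
  unfold sqNorm; fun_prop

theorem continuous_gauss (n : ℕ) (s : ℝ) : Continuous (gauss n s) := by
  unfold gauss
  have := continuous_sqNorm (n := n)
  fun_prop

theorem gauss_pos (n : ℕ) {s : ℝ} (hs : 0 < s) (z : Fin n → ℂ) : 0 < gauss n s z := by
  unfold gauss; positivity

theorem measurable_density (n : ℕ) (s : ℝ) :
    Measurable (fun z : Fin n → ℂ => ENNReal.ofReal (gauss n s z)) :=
  (continuous_gauss n s).measurable.ennreal_ofReal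

theorem gauss_eq_prod (n : ℕ) (s : ℝ) (z : Fin n → ℂ) :
    gauss n s z = ∏ i, (1 / (Real.pi * s) * Real.exp (-(1 / s) * ‖z i‖ ^ 2)) := by
  unfold gauss sqNorm
  rw [Finset.prod_mul_distrib, ← Real.exp_sum]
  simp only [Finset.prod_const, Finset.card_univ, Fintype.card_fin, one_div, inv_pow]
  congr 2
  rw [← Finset.mul_sum]
  ring

theorem integral_gauss_one {s : ℝ} (hs : 0 < s) :
    ∫ z : ℂ, 1 / (Real.pi * s) * Real.exp (-(1 / s) * ‖z‖ ^ 2) = 1 := by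
  rw [integral_const_mul, GaussianFourier.integral_rexp_neg_mul_sq_norm (by positivity)]
  simp only [Complex.finrank_real_complex]
  norm_num
  have := Real.pi_pos.ne'
  field_simp

theorem integral_gauss (n : ℕ) {s : ℝ} (hs : 0 < s) : ∫ z, gauss n s z = 1 := by
  simp_rw [gauss_eq_prod]
  rw [integral_fintype_prod_volume_eq_prod
    (fun (_ : Fin n) (z : ℂ) => 1 / (Real.pi * s) * Real.exp (-(1 / s) * ‖z‖ ^ 2))]
  simp_rw [integral_gauss_one hs]
  simp

theorem isProbabilityMeasure_gauss (n : ℕ) {s : ℝ} (hs : 0 < s) :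
    IsProbabilityMeasure (gaussMeasure n s) := by
  constructor
  have hi : Integrable (gauss n s) := by
    by_contra h
    have := integral_undef h
    rw [integral_gauss n hs] at this
    exact one_ne_zero this
  rw [gaussMeasure, withDensity_apply _ MeasurableSet.univ, Measure.restrict_univ,
    ← ofReal_integral_eq_lintegral_ofReal hi (Eventually.of_forall fun z => (gauss_pos n hs z).le),
    integral_gauss n hs, ENNReal.ofReal_one]

theorem ae_volume_of_ae_gauss {n : ℕ} {s : ℝ} (hs : 0 < s) {q : (Fin n → ℂ) → Prop}
    (h : ∀ᵐ z ∂(gaussMeasure n s), q z) : ∀ᵐ z, q z := by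
  rw [gaussMeasure, ae_withDensity_iff (measurable_density n s)] at h
  filter_upwards [h] with z hz
  exact hz (by simpa using gauss_pos n hs z)

theorem lintegral_gauss {n : ℕ} {s : ℝ} (F : (Fin n → ℂ) → ℝ≥0∞) :
    ∫⁻ z, F z ∂(gaussMeasure n s) = ∫⁻ z, ENNReal.ofReal (gauss n s z) * F z := by
  rw [gaussMeasure, lintegral_withDensity_eq_lintegral_mul_non_measurable _
    (measurable_density n s) (Eventually.of_forall fun z => ENNReal.ofReal_lt_top)]
  rfl

/-! ### The Fock space `F_t^p` -/

/-- The vector space `L^p(ℂⁿ, μ_{2t/p}) ∩ Hol(ℂⁿ)`. -/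
def fockSubmodule (n : ℕ) (p t : ℝ) : Submodule ℂ ((Fin n → ℂ) → ℂ) where
  carrier := {f | Differentiable ℂ f ∧ MemLp f (ENNReal.ofReal p) (gaussMeasure n (2 * t / p))}
  add_mem' hf hg := ⟨hf.1.add hg.1, hf.2.add hg.2⟩
  zero_mem' := ⟨differentiable_const 0, MemLp.zero⟩
  smul_mem' c _ hf := ⟨hf.1.const_smul c, hf.2.const_smul c⟩

/-- The Fock space `F_t^p`; it carries the norm of `L^p(ℂⁿ, μ_{2t/p})`, see below. -/
def FockSpace (n : ℕ) (p t : ℝ) : Type := ↥(fockSubmodule n p t)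

instance (n : ℕ) (p t : ℝ) : AddCommGroup (FockSpace n p t) :=
  inferInstanceAs (AddCommGroup ↥(fockSubmodule n p t))

instance (n : ℕ) (p t : ℝ) : Module ℂ (FockSpace n p t) :=
  inferInstanceAs (Module ℂ ↥(fockSubmodule n p t))

instance (n : ℕ) (p t : ℝ) : CoeFun (FockSpace n p t) (fun _ => (Fin n → ℂ) → ℂ) :=
  ⟨fun f => f.1⟩

theorem scale_pos {p t : ℝ} (hp : 1 < p) (ht : 0 < t) : 0 < 2 * t / p := by
  have : 0 < p := by linarith
  positivity

section Space

variable {n : ℕ} {p t : ℝ}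

theorem FockSpace.ext {f g : FockSpace n p t} (h : ∀ w, f w = g w) : f = g :=
  Subtype.ext (funext h)

variable [hp : Fact (1 < p)] [ht : Fact (0 < t)]

instance instFactOneLe : Fact (1 ≤ ENNReal.ofReal p) :=
  ⟨by rw [← ENNReal.ofReal_one]; exact ENNReal.ofReal_le_ofReal hp.out.le⟩

/-- The inclusion of `F_t^p` into `L^p(ℂⁿ, μ_{2t/p})`. -/
def fockToLp (n : ℕ) (p t : ℝ) [Fact (1 < p)] :
    FockSpace n p t →ₗ[ℂ] Lp ℂ (ENNReal.ofReal p) (gaussMeasure n (2 * t / p)) where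
  toFun f := f.2.2.toLp f.1
  map_add' _ _ := rfl
  map_smul' _ _ := rfl

theorem fockToLp_injective : Function.Injective (fockToLp n p t) := by
  intro f g h
  have h1 : f.1 =ᵐ[gaussMeasure n (2 * t / p)] g.1 :=
    (MemLp.toLp_eq_toLp_iff f.2.2 g.2.2).1 h
  have h2 : f.1 =ᵐ[volume] g.1 := ae_volume_of_ae_gauss (scale_pos hp.out ht.out) h1
  exact Subtype.ext
    ((Continuous.ae_eq_iff_eq volume f.2.1.continuous g.2.1.continuous).1 h2)

instance instNormedAddCommGroup : NormedAddCommGroup (FockSpace n p t) :=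
  NormedAddCommGroup.induced _ _ (fockToLp n p t) fockToLp_injective

instance instNormedSpace : NormedSpace ℂ (FockSpace n p t) :=
  NormedSpace.induced ℂ _ _ (fockToLp n p t)

theorem norm_def (f : FockSpace n p t) :
    ‖f‖ = (eLpNorm f.1 (ENNReal.ofReal p) (gaussMeasure n (2 * t / p))).toReal :=
  Lp.norm_toLp f.1 f.2.2

/-! ### Weyl operators, parity, evaluation at the origin -/

theorem eLpNorm_fock (h : (Fin n → ℂ) → ℂ) :
    eLpNorm h (ENNReal.ofReal p) (gaussMeasure n (2 * t / p)) =
      (∫⁻ w, ENNReal.ofReal (gauss n (2 * t / p) w) * ‖h w‖ₑ ^ p) ^ (1 / p) := by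
  have hp0 : 0 < p := by linarith [hp.out]
  rw [eLpNorm_eq_lintegral_rpow_enorm_toReal (by simpa using hp0) ENNReal.ofReal_ne_top,
    lintegral_gauss, ENNReal.toReal_ofReal hp0.le]

theorem sqNorm_sub (w z : Fin n → ℂ) :
    sqNorm (w - z) = sqNorm w - 2 * (hdot w z).re + sqNorm z := by
  unfold sqNorm hdot
  rw [Complex.re_sum, Finset.mul_sum, ← Finset.sum_sub_distrib, ← Finset.sum_add_distrib]
  refine Finset.sum_congr rfl fun i _ => ?_
  simp only [← Complex.normSq_eq_norm_sq, Complex.normSq_apply, Pi.sub_apply, Complex.sub_re,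
    Complex.sub_im, Complex.mul_re, Complex.conj_re, Complex.conj_im]
  ring

theorem norm_nkernel (z w : Fin n → ℂ) :
    ‖nkernel t z w‖ = Real.exp ((hdot w z).re / t - sqNorm z / (2 * t)) := by
  rw [nkernel, Complex.norm_exp, Complex.sub_re, Complex.ofReal_re, Complex.div_ofReal_re]

theorem weyl_density (z w : Fin n → ℂ) :
    gauss n (2 * t / p) w * ‖nkernel t z w‖ ^ p = gauss n (2 * t / p) (w - z) := by
  have hp0 : p ≠ 0 := by linarith [hp.out]
  have ht0 : t ≠ 0 := ht.out.ne'
  rw [norm_nkernel, ← Real.exp_mul, gauss, gauss, mul_assoc, ← Real.exp_add, sqNorm_sub]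
  congr 2
  field_simp
  ring

theorem eLpNorm_weyl (z : Fin n → ℂ) (h : (Fin n → ℂ) → ℂ) :
    eLpNorm (fun w => nkernel t z w * h (w - z)) (ENNReal.ofReal p)
        (gaussMeasure n (2 * t / p)) =
      eLpNorm h (ENNReal.ofReal p) (gaussMeasure n (2 * t / p)) := by
  have hp0 : 0 ≤ p := by linarith [hp.out]
  rw [eLpNorm_fock, eLpNorm_fock]
  congr 1
  rw [← lintegral_sub_right_eq_self
    (fun w => ENNReal.ofReal (gauss n (2 * t / p) w) * ‖h w‖ₑ ^ p) z]
  refine lintegral_congr fun w => ?_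
  rw [← weyl_density (p := p) (t := t) z w, enorm_mul, ENNReal.mul_rpow_of_nonneg _ _ hp0,
    ← mul_assoc, ENNReal.ofReal_mul (gauss_pos n (scale_pos hp.out ht.out) w).le,
    ← ENNReal.ofReal_rpow_of_nonneg (norm_nonneg _) hp0, ofReal_norm]

theorem differentiable_weyl (z : Fin n → ℂ) {h : (Fin n → ℂ) → ℂ} (hh : Differentiable ℂ h) :
    Differentiable ℂ (fun w => nkernel t z w * h (w - z)) := by
  have : Differentiable ℂ (fun w => nkernel t z w) := by
    unfold nkernel hdot; fun_prop
  fun_prop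

/-- The Weyl operator `(W_z f)(w) = k_z(w) f(w - z)` on `F_t^p`. -/
def weyl (z : Fin n → ℂ) : FockSpace n p t →L[ℂ] FockSpace n p t :=
  LinearMap.mkContinuous
    { toFun := fun f => ⟨fun w => nkernel t z w * f (w - z),
        differentiable_weyl z f.2.1,
        (differentiable_weyl z f.2.1).continuous.aestronglyMeasurable,
        by rw [eLpNorm_weyl]; exact f.2.2.2⟩
      map_add' := fun f g => FockSpace.ext fun w => mul_add _ (f (w - z)) (g (w - z))
      map_smul' := fun c f => FockSpace.ext fun w => mul_left_comm _ c (f (w - z)) } 1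
    (fun f => by
      rw [norm_def, norm_def, one_mul]
      exact (congrArg ENNReal.toReal (eLpNorm_weyl z f.1)).le)

theorem weyl_apply (z : Fin n → ℂ) (f : FockSpace n p t) (w : Fin n → ℂ) :
    weyl z f w = nkernel t z w * f (w - z) := rfl

theorem eLpNorm_parity (h : (Fin n → ℂ) → ℂ) :
    eLpNorm (fun w => h (-w)) (ENNReal.ofReal p) (gaussMeasure n (2 * t / p)) =
      eLpNorm h (ENNReal.ofReal p) (gaussMeasure n (2 * t / p)) := by
  rw [eLpNorm_fock, eLpNorm_fock]
  congr 1
  rw [← lintegral_neg_eq_self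
    (fun w => ENNReal.ofReal (gauss n (2 * t / p) w) * ‖h w‖ₑ ^ p)]
  refine lintegral_congr fun w => ?_
  simp [gauss, sqNorm]

theorem differentiable_parity {h : (Fin n → ℂ) → ℂ} (hh : Differentiable ℂ h) :
    Differentiable ℂ (fun w => h (-w)) := by
  fun_prop

/-- The parity operator `(U f)(w) = f(-w)` on `F_t^p`. -/
def parity : FockSpace n p t →L[ℂ] FockSpace n p t :=
  LinearMap.mkContinuous
    { toFun := fun f => ⟨fun w => f (-w), differentiable_parity f.2.1,
        (differentiable_parity f.2.1).continuous.aestronglyMeasurable,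
        by rw [eLpNorm_parity]; exact f.2.2.2⟩
      map_add' := fun _ _ => rfl
      map_smul' := fun _ _ => rfl } 1
    (fun f => by
      rw [norm_def, norm_def, one_mul]
      exact (congrArg ENNReal.toReal (eLpNorm_parity f.1)).le)

/-- The constant function `1` as an element of `F_t^p`. -/
def fockOne : FockSpace n p t :=
  ⟨fun _ => 1, differentiable_const 1,
    haveI := isProbabilityMeasure_gauss n (scale_pos hp.out ht.out)
    memLp_const 1⟩

theorem gauss_rotate (s : ℝ) {c : ℂ} (hc : ‖c‖ = 1) (z : Fin n → ℂ) :
    gauss n s (fun i => c * z i) = gauss n s z := by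
  simp [gauss, sqNorm, hc]

theorem lintegral_rotate {s : ℝ} {c : ℂ} (hc : ‖c‖ = 1) {F : (Fin n → ℂ) → ℝ≥0∞}
    (hF : Measurable F) :
    ∫⁻ z, F (fun i => c * z i) ∂(gaussMeasure n s) = ∫⁻ z, F z ∂(gaussMeasure n s) := by
  have h1 : MeasurePreserving (fun z : ℂ => c * z) volume volume :=
    (rotation ⟨c, mem_sphere_zero_iff_norm.2 hc⟩).measurePreserving
  have h2 : MeasurePreserving (fun (z : Fin n → ℂ) i => c * z i) volume volume :=
    volume_preserving_pi (fun _ => h1)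
  rw [lintegral_gauss, lintegral_gauss]
  refine Eq.trans ?_ (h2.lintegral_comp ((measurable_density n s).mul hF))
  refine lintegral_congr fun z => ?_
  simp only [Pi.mul_apply, gauss_rotate s hc]

theorem enorm_zero_le_circle (f : FockSpace n p t) (z : Fin n → ℂ) :
    ‖f 0‖ₑ ≤ ENNReal.ofReal (2 * Real.pi)⁻¹ *
      ∫⁻ θ in Set.Ioc 0 (2 * Real.pi), ‖f (fun i => circleMap 0 1 θ * z i)‖ₑ := by
  have hd : Differentiable ℂ (fun l : ℂ => f.1 (fun i => l * z i)) :=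
    f.2.1.comp (by fun_prop)
  have h := (hd.diffContOnCl (s := Metric.ball 0 |1|)).circleAverage
  have h0 : f 0 = f.1 (fun i => (0 : ℂ) * z i) := by
    refine congrArg f.1 ?_; funext i; simp
  rw [h0, ← h, Real.circleAverage, enorm_smul, intervalIntegral.integral_of_le Real.two_pi_pos.le]
  gcongr
  · rw [← ofReal_norm, Real.norm_of_nonneg (by positivity)]
  · exact enorm_integral_le_lintegral_enorm _

theorem norm_zero_le (f : FockSpace n p t) : ‖f 0‖ ≤ ‖f‖ := by
  have hs := scale_pos hp.out ht.out
  have := isProbabilityMeasure_gauss n hs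
  have hc : Continuous f.1 := f.2.1.continuous
  have hm : Measurable (fun z => ‖f z‖ₑ) := hc.measurable.enorm
  have key : ‖f 0‖ₑ ≤ ∫⁻ z, ‖f z‖ₑ ∂(gaussMeasure n (2 * t / p)) := by
    calc ‖f 0‖ₑ = ∫⁻ _, ‖f 0‖ₑ ∂(gaussMeasure n (2 * t / p)) := by simp
      _ ≤ ∫⁻ z : Fin n → ℂ, (ENNReal.ofReal (2 * Real.pi)⁻¹ *
            ∫⁻ θ : ℝ in Set.Ioc 0 (2 * Real.pi), ‖f (fun i => circleMap 0 1 θ * z i)‖ₑ)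
            ∂(gaussMeasure n (2 * t / p)) := lintegral_mono (enorm_zero_le_circle f)
      _ = ENNReal.ofReal (2 * Real.pi)⁻¹ * ∫⁻ θ : ℝ in Set.Ioc 0 (2 * Real.pi),
            ∫⁻ z : Fin n → ℂ, ‖f (fun i => circleMap 0 1 θ * z i)‖ₑ ∂(gaussMeasure n (2 * t / p)) := by
          rw [lintegral_const_mul' _ _ ENNReal.ofReal_ne_top, lintegral_lintegral_swap]
          refine Continuous.aemeasurable (Continuous.enorm (hc.comp ?_))
          have := continuous_circleMap 0 1
          fun_prop
      _ = ENNReal.ofReal (2 * Real.pi)⁻¹ * ∫⁻ _ : ℝ in Set.Ioc 0 (2 * Real.pi),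
            ∫⁻ z, ‖f z‖ₑ ∂(gaussMeasure n (2 * t / p)) := by
          congr 1
          refine lintegral_congr fun θ => ?_
          exact lintegral_rotate (by simp) hm
      _ = ∫⁻ z, ‖f z‖ₑ ∂(gaussMeasure n (2 * t / p)) := by
          rw [setLIntegral_const, Real.volume_Ioc, sub_zero, mul_comm, mul_assoc,
            ← ENNReal.ofReal_mul (by positivity), mul_inv_cancel₀ (by positivity)]
          simp
  rw [norm_def, ← toReal_enorm]
  refine ENNReal.toReal_mono f.2.2.2.ne (key.trans ?_)
  rw [← eLpNorm_one_eq_lintegral_enorm]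
  exact eLpNorm_le_eLpNorm_of_exponent_le instFactOneLe.out hc.aestronglyMeasurable

/-- The rank one operator `P_ℂ f = f(0)` (a constant function) on `F_t^p`. -/
def projConst : FockSpace n p t →L[ℂ] FockSpace n p t :=
  ContinuousLinearMap.smulRight
    (LinearMap.mkContinuous
      { toFun := fun f : FockSpace n p t => f 0
        map_add' := fun _ _ => rfl
        map_smul' := fun _ _ => rfl } 1
      (fun f => by rw [one_mul]; exact norm_zero_le f)) fockOne

/-- The operator `R_t = (π t)⁻ⁿ P_ℂ`. -/
def Rop : FockSpace n p t →L[ℂ] FockSpace n p t :=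
  ((1 / (Real.pi * t) ^ n : ℝ) : ℂ) • projConst

/-- The action `α_z(A) = W_z A W_{-z}` of `ℂⁿ` on bounded operators. -/
def shift (z : Fin n → ℂ) (A : FockSpace n p t →L[ℂ] FockSpace n p t) :
    FockSpace n p t →L[ℂ] FockSpace n p t :=
  (weyl z).comp (A.comp (weyl (-z)))

end Space

/-! ### Nuclear operators and convolutions -/

/-- A nuclear operator `N = ∑ j, y j ⊗ x j`, `(y ⊗ x) v = y(v) x`, given by a representation with
`∑ j, ‖y j‖ ‖x j‖ < ∞`. -/
structure NuclearSeries (X : Type*) [NormedAddCommGroup X] [NormedSpace ℂ X] where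
  y : ℕ → (X →L[ℂ] ℂ)
  x : ℕ → X
  summable : Summable fun j => ‖y j‖ * ‖x j‖

/-- The trace pairing `⟨A, N⟩ = Tr(A N) = Tr(N A) = ∑ j, y j (A (x j))` of a bounded operator with
a nuclear operator. The series converges absolutely. -/
def trPair {X : Type*} [NormedAddCommGroup X] [NormedSpace ℂ X] (A : X →L[ℂ] X)
    (N : NuclearSeries X) : ℂ :=
  ∑' j, N.y j (A (N.x j))

section Convolution

variable {n : ℕ} {p t : ℝ} [hp : Fact (1 < p)] [ht : Fact (0 < t)]

/-- `C = g ∗ A` for `g ∈ L¹(ℂⁿ)` and a bounded operator `A`: `C = ∫ g(z) α_z(A) dV(z)` as a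
weak* integral, `⟨C, N⟩ = ∫ g(z) ⟨α_z(A), N⟩ dV(z)` for every nuclear `N`. Since
`Tr (α_z(A) N) = Tr (A α_{-z}(N))`, this is the duality relation `⟨C, N⟩ = ⟨A, (U g) ∗ N⟩` with
`(U g)(z) = g(-z)` and `(U g) ∗ N = ∫ g(-z) α_z(N) dV(z)`. -/
def IsConvFun (g : (Fin n → ℂ) → ℂ) (A C : FockSpace n p t →L[ℂ] FockSpace n p t) : Prop :=
  ∀ N : NuclearSeries (FockSpace n p t),
    Integrable (fun z => g z * trPair (shift z A) N) volume ∧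
      trPair C N = ∫ z, g z * trPair (shift z A) N

/-- The convolution of a nuclear operator with a bounded operator, `(N ∗ A)(z) = Tr (N α_z(U A U))`,
a function on `ℂⁿ`. -/
def convOpOp (N : NuclearSeries (FockSpace n p t)) (A : FockSpace n p t →L[ℂ] FockSpace n p t)
    (z : Fin n → ℂ) : ℂ :=
  trPair (shift z (parity.comp (A.comp parity))) N

/-- `C = A ∗ f` for a nuclear operator `A` and `f ∈ L^∞(ℂⁿ)`: for every nuclear `N`,
`⟨C, N⟩ = ∫ f(z) (N ∗ (U A U))(z) dV(z)`. -/
def IsConvOp (A : FockSpace n p t →L[ℂ] FockSpace n p t) (f : (Fin n → ℂ) → ℂ)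
    (C : FockSpace n p t →L[ℂ] FockSpace n p t) : Prop :=
  ∀ N : NuclearSeries (FockSpace n p t),
    Integrable (fun z => f z * convOpOp N (parity.comp (A.comp parity)) z) volume ∧
      trPair C N = ∫ z, f z * convOpOp N (parity.comp (A.comp parity)) z

open Classical in
/-- The convolution `g ∗ A`, the operator determined by `IsConvFun g A`. -/
def convFun (g : (Fin n → ℂ) → ℂ) (A : FockSpace n p t →L[ℂ] FockSpace n p t) :
    FockSpace n p t →L[ℂ] FockSpace n p t :=
  if h : ∃ C, IsConvFun g A C then h.choose else 0

open Classical in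
/-- The convolution `A ∗ f`, the operator determined by `IsConvOp A f`. -/
def convOp (A : FockSpace n p t →L[ℂ] FockSpace n p t) (f : (Fin n → ℂ) → ℂ) :
    FockSpace n p t →L[ℂ] FockSpace n p t :=
  if h : ∃ C, IsConvOp A f C then h.choose else 0

/-- `C₁`: the bounded operators `A` for which `z ↦ α_z(A)` is continuous in operator norm. -/
def C1 (n : ℕ) (p t : ℝ) [Fact (1 < p)] [Fact (0 < t)] :
    Set (FockSpace n p t →L[ℂ] FockSpace n p t) :=
  {A | Continuous fun z => shift z A}

/-- `T` is the Toeplitz operator with symbol `f`: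
`(T h)(w) = P_t (f h)(w) = ∫ exp (w · z̄ / t) f(z) h(z) dμ_t(z)`. -/
def IsToeplitz (f : (Fin n → ℂ) → ℂ) (T : FockSpace n p t →L[ℂ] FockSpace n p t) : Prop :=
  ∀ (h : FockSpace n p t) (w : Fin n → ℂ),
    Integrable (fun z => Complex.exp (hdot w z / (t : ℂ)) * (f z * h z)) (gaussMeasure n t) ∧
      T h w = ∫ z, Complex.exp (hdot w z / (t : ℂ)) * (f z * h z) ∂(gaussMeasure n t)

end Convolution

/-- The bounded uniformly continuous functions on `ℂⁿ`. -/
def BUC (n : ℕ) : Set ((Fin n → ℂ) → ℂ) :=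
  {f | UniformContinuous f ∧ ∃ M : ℝ, ∀ z, ‖f z‖ ≤ M}

end PFock

end

noncomputable section

set_option linter.unusedSectionVars false

namespace PFock

/-! ### A Riesz–Scheffé lemma -/

/-! Both kinds of convolution are weak integrals `∫ g(z) α_z(A) dz`. The Weyl phases cancel in
`α_z`, so `α` is an isometric action of the group `ℂⁿ` on the bounded operators, and `C1` is the
closed subspace of vectors with norm continuous orbit.

For `g ∈ L¹`, shifting `g ∗ B` translates `g`, and translation is continuous in `L¹`; hence `g ∗ B ∈
C1` for every bounded `B`. Conversely, on `C1` the convolution is a Bochner integral and the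
Gaussians are an approximate identity. This gives the closed span and the Gaussian description. The
exact factorization `A = g ∗ B` is Cohen's theorem for the action restricted to `C1`
(`exists_convL_eq`).

The function `f` in `R_t ∗ f` is only bounded, so the decay must come from `R_t`. One has `α_z(R_t)
x = φ(z) k_z`, where `φ` is `x` times a Gaussian weight and lies in `L^p`. The map `φ ↦ ∫ φ(z) k_z
dz` is bounded from `L^p` to `F_t^p`, because after taking absolute values it is a Gaussian
convolution. By duality `∫ |y(α_z(R_t) x)| dz ≤ K ‖y‖ ‖x‖`. Hence `R_t ∗ f` exists, has norm at most
`K sup |f|`, and lies in `C1` if `f` is uniformly continuous. Testing against point evaluations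
gives the Toeplitz formula.

For density, the Berezin transform is injective (`eq_zero_of_diagonal`), and comparing Berezin
transforms shows that `f_t ∗ A` is the Toeplitz operator whose symbol is the Berezin transform of
`A`, for `A ∈ C1`. A functional `ℓ` that kills all Toeplitz operators therefore kills `f_t ∗ α_v(A)`
for all `v`, so the bounded continuous function `ψ(w) = ℓ(α_w(A))` is annihilated by all translates
of `f_t`. A Wiener type statement (`eq_zero_of_integral_gauss_eq_zero`) gives `ψ(0) = ℓ(A) = 0`, and
Hahn–Banach concludes. -/

/-- Fatou's lemma for the nonnegative functions `c (|a_k|^q + |b|^q) - |a_k - b|^q`: equality of the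
norms makes the integral of the first term the same number `K` for all `k`. It serves the strong
continuity of `z ↦ W_z f`, where all the norms agree. -/
theorem tendsto_lintegral_enorm_sub_rpow {α : Type*} [MeasurableSpace α] {μ : Measure α} {q : ℝ}
    (hq : 0 < q) {a : ℕ → α → ℂ} {b : α → ℂ} (ha : ∀ k, Measurable (a k)) (hb : Measurable b)
    (hab : ∀ x, Tendsto (fun k => a k x) atTop (𝓝 (b x)))
    (hI : ∫⁻ x, ‖b x‖ₑ ^ q ∂μ ≠ ∞) (hk : ∀ k, ∫⁻ x, ‖a k x‖ₑ ^ q ∂μ = ∫⁻ x, ‖b x‖ₑ ^ q ∂μ) :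
    Tendsto (fun k => ∫⁻ x, ‖a k x - b x‖ₑ ^ q ∂μ) atTop (𝓝 0) := by
  set c : ℝ≥0∞ := 2 ^ q with hc
  have hc' : c ≠ ∞ := ENNReal.rpow_ne_top_of_nonneg hq.le (by simp)
  set K : ℝ≥0∞ := c * ((∫⁻ x, ‖b x‖ₑ ^ q ∂μ) + ∫⁻ x, ‖b x‖ₑ ^ q ∂μ) with hK
  have hK' : K ≠ ∞ := ENNReal.mul_ne_top hc' (by simp [hI])
  have hle : ∀ k x, ‖a k x - b x‖ₑ ^ q ≤ c * (‖a k x‖ₑ ^ q + ‖b x‖ₑ ^ q) := by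
    intro k x
    have h1 : ‖a k x - b x‖ₑ ≤ 2 * max ‖a k x‖ₑ ‖b x‖ₑ := by
      refine (enorm_sub_le).trans ?_
      rw [two_mul]
      exact add_le_add (le_max_left _ _) (le_max_right _ _)
    refine (ENNReal.rpow_le_rpow h1 hq.le).trans ?_
    rw [ENNReal.mul_rpow_of_nonneg _ _ hq.le]
    gcongr
    rcases max_cases ‖a k x‖ₑ ‖b x‖ₑ with h | h <;> rw [h.1]
    · exact le_self_add
    · exact le_add_self
  have hm1 : ∀ k, Measurable fun x => ‖a k x‖ₑ ^ q := fun k => (ha k).enorm.pow_const q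
  have hm2 : Measurable fun x => ‖b x‖ₑ ^ q := hb.enorm.pow_const q
  have hm3 : ∀ k, Measurable fun x => ‖a k x - b x‖ₑ ^ q :=
    fun k => ((ha k).sub hb).enorm.pow_const q
  have hsum : ∀ k, ∫⁻ x, c * (‖a k x‖ₑ ^ q + ‖b x‖ₑ ^ q) ∂μ = K := by
    intro k
    rw [lintegral_const_mul' _ _ hc', lintegral_add_left (hm1 k), hk]
  have hJ : ∀ k, ∫⁻ x, ‖a k x - b x‖ₑ ^ q ∂μ ≤ K := fun k =>
    (lintegral_mono (hle k)).trans (hsum k).le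
  have hdiff : ∀ k, ∫⁻ x, (c * (‖a k x‖ₑ ^ q + ‖b x‖ₑ ^ q) - ‖a k x - b x‖ₑ ^ q) ∂μ
      = K - ∫⁻ x, ‖a k x - b x‖ₑ ^ q ∂μ := by
    intro k
    rw [lintegral_sub (hm3 k) (ne_top_of_le_ne_top hK' (hJ k)) (Eventually.of_forall (hle k)),
      hsum]
  have hpt : ∀ x, Tendsto (fun k => c * (‖a k x‖ₑ ^ q + ‖b x‖ₑ ^ q) - ‖a k x - b x‖ₑ ^ q) atTop
      (𝓝 (c * (‖b x‖ₑ ^ q + ‖b x‖ₑ ^ q))) := by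
    intro x
    have h1 : Tendsto (fun k => ‖a k x‖ₑ ^ q) atTop (𝓝 (‖b x‖ₑ ^ q)) :=
      ((ENNReal.continuous_rpow_const).tendsto _).comp ((continuous_enorm.tendsto _).comp (hab x))
    have h2 : Tendsto (fun k => ‖a k x - b x‖ₑ ^ q) atTop (𝓝 0) := by
      have h3 := ((ENNReal.continuous_rpow_const (y := q)).tendsto _).comp
        ((continuous_enorm.tendsto _).comp ((hab x).sub_const (b x)))
      simpa [Function.comp_def, ENNReal.zero_rpow_of_pos hq] using h3
    have h4 := ENNReal.Tendsto.sub
      (ENNReal.Tendsto.const_mul (h1.add_const (‖b x‖ₑ ^ q)) (Or.inr hc')) h2 (Or.inr (by simp))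
    simpa using h4
  -- Fatou: the pointwise limit of the differences is `2 c |b|^q`, whose integral is `K`.
  have hfat : K ≤ liminf (fun k => K - ∫⁻ x, ‖a k x - b x‖ₑ ^ q ∂μ) atTop := by
    have h := lintegral_liminf_le (μ := μ) (u := atTop)
      (f := fun k x => c * (‖a k x‖ₑ ^ q + ‖b x‖ₑ ^ q) - ‖a k x - b x‖ₑ ^ q)
      (fun k => (((hm1 k).add hm2).const_mul c).sub (hm3 k))
    simp only [hdiff] at h
    refine le_trans (le_of_eq ?_) h
    simp only [(hpt _).liminf_eq]
    rw [lintegral_const_mul' _ _ hc', lintegral_add_left hm2]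
  have hlim : Tendsto (fun k => K - ∫⁻ x, ‖a k x - b x‖ₑ ^ q ∂μ) atTop (𝓝 K) := by
    refine tendsto_of_le_liminf_of_limsup_le hfat ?_
    exact limsup_le_of_le (by isBoundedDefault) (Eventually.of_forall fun k => tsub_le_self)
  have h := ENNReal.Tendsto.sub (tendsto_const_nhds (x := K)) hlim (Or.inl hK')
  simpa only [ENNReal.sub_sub_cancel hK' (hJ _), tsub_self] using h

section Space

variable {n : ℕ} {p t : ℝ} [hp : Fact (1 < p)] [ht : Fact (0 < t)]

/-! ### Pointwise evaluation -/

theorem sqNorm_neg (z : Fin n → ℂ) : sqNorm (-z) = sqNorm z := by simp [sqNorm]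

theorem hdot_zero_left (z : Fin n → ℂ) : hdot 0 z = 0 := by simp [hdot]

theorem norm_weyl (z : Fin n → ℂ) (f : FockSpace n p t) : ‖weyl z f‖ = ‖f‖ := by
  rw [norm_def, norm_def]
  exact congrArg ENNReal.toReal (eLpNorm_weyl z f.1)

/-- The isometry `W_{-w}` moves the point `w` to the origin, where `norm_zero_le` applies. -/
theorem norm_apply_le (w : Fin n → ℂ) (f : FockSpace n p t) :
    ‖f w‖ ≤ Real.exp (sqNorm w / (2 * t)) * ‖f‖ := by
  have h := norm_zero_le (weyl (-w) f)
  rw [norm_weyl, weyl_apply, norm_mul, norm_nkernel, hdot_zero_left, sqNorm_neg, zero_sub,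
    neg_neg] at h
  simp only [Complex.zero_re, zero_div, zero_sub, Real.exp_neg] at h
  rwa [inv_mul_le_iff₀ (Real.exp_pos _)] at h

/-- Evaluation at `w` as a bounded functional on `F_t^p`. -/
def evalCLM (w : Fin n → ℂ) : FockSpace n p t →L[ℂ] ℂ :=
  LinearMap.mkContinuous
    { toFun := fun f : FockSpace n p t => f w
      map_add' := fun _ _ => rfl
      map_smul' := fun _ _ => rfl } (Real.exp (sqNorm w / (2 * t))) (norm_apply_le w)

theorem evalCLM_apply (w : Fin n → ℂ) (f : FockSpace n p t) : evalCLM w f = f w := rfl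

/-- Cauchy's estimate on the unit circle of each complex line through `z`. -/
theorem norm_fderiv_le {M : ℝ} (z : Fin n → ℂ)
    (hM : ∀ w ∈ Metric.closedBall z 1, Real.exp (sqNorm w / (2 * t)) ≤ M) (f : FockSpace n p t) :
    ‖fderiv ℂ f.1 z‖ ≤ M * ‖f‖ := by
  have hM0 : 0 ≤ M := (Real.exp_pos _).le.trans (hM z (by simp))
  refine ContinuousLinearMap.opNorm_le_of_unit_norm (𝕜 := ℂ) (by positivity) fun v hv => ?_
  have hd : HasDerivAt (fun l : ℂ => f.1 (z + l • v)) (fderiv ℂ f.1 z v) 0 := by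
    have h1 : HasDerivAt (fun l : ℂ => z + l • v) v 0 := by
      simpa using ((hasDerivAt_id (0 : ℂ)).smul_const v).const_add z
    have h2 : HasFDerivAt f.1 (fderiv ℂ f.1 z) (z + (0 : ℂ) • v) := by
      simpa using (f.2.1 z).hasFDerivAt
    exact h2.comp_hasDerivAt 0 h1
  rw [← hd.deriv]
  have hdiff : Differentiable ℂ (fun l : ℂ => f.1 (z + l • v)) := f.2.1.comp (by fun_prop)
  have := Complex.norm_deriv_le_of_forall_mem_sphere_norm_le (c := (0 : ℂ)) (R := 1)
    (C := M * ‖f‖) one_pos hdiff.diffContOnCl (fun l hl => by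
      refine (norm_apply_le _ f).trans (mul_le_mul_of_nonneg_right (hM _ ?_) (norm_nonneg _))
      have : ‖l‖ = 1 := by simpa using hl
      simp [norm_smul, this, hv])
  simpa using this

theorem exists_bound_exp_sqNorm {K : Set (Fin n → ℂ)} (hK : IsCompact K) (c : ℝ) :
    ∃ M, ∀ z ∈ K, Real.exp (sqNorm z / c) ≤ M := by
  have hc : Continuous fun z : Fin n → ℂ => Real.exp (sqNorm z / c) := by
    have := continuous_sqNorm (n := n); fun_prop
  obtain ⟨M, hM⟩ := (hK.image hc).bddAbove
  exact ⟨M, fun z hz => hM ⟨z, hz, rfl⟩⟩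

/-! ### Completeness -/

theorem norm_fockToLp (f : FockSpace n p t) : ‖fockToLp n p t f‖ = ‖f‖ := rfl

theorem isometry_fockToLp : Isometry (fockToLp n p t) :=
  AddMonoidHomClass.isometry_of_norm (fockToLp n p t) norm_fockToLp

/-- By Cauchy's estimate the derivatives are uniformly Cauchy on compact sets, so the pointwise
limit may be differentiated. -/
theorem differentiable_of_tendsto {u : ℕ → FockSpace n p t} (hu : CauchySeq u)
    {F : (Fin n → ℂ) → ℂ} (hF : ∀ w, Tendsto (fun k => u k w) atTop (𝓝 (F w))) :
    Differentiable ℂ F := by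
  have key : ∀ K : Set (Fin n → ℂ), IsCompact K →
      UniformCauchySeqOn (fun k => fderiv ℂ (u k).1) atTop K := by
    intro K hK
    obtain ⟨M, hM⟩ := exists_bound_exp_sqNorm (hK.cthickening (r := 1)) (2 * t)
    have hest : ∀ z ∈ K, ∀ f : FockSpace n p t, ‖fderiv ℂ f.1 z‖ ≤ M * ‖f‖ := fun z hz f =>
      norm_fderiv_le z (fun w hw => hM w (Metric.closedBall_subset_cthickening hz 1 hw)) f
    rw [Metric.uniformCauchySeqOn_iff]
    intro ε hε
    obtain ⟨N, hN⟩ := Metric.cauchySeq_iff.1 hu (ε / (|M| + 1)) (by positivity)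
    refine ⟨N, fun k hk m hm z hz => ?_⟩
    have h1 := hest z hz (u k - u m)
    have h2 : fderiv ℂ (u k - u m).1 z = fderiv ℂ (u k).1 z - fderiv ℂ (u m).1 z :=
      fderiv_sub ((u k).2.1 z) ((u m).2.1 z)
    rw [h2] at h1
    rw [dist_eq_norm]
    have h3 := hN k hk m hm
    rw [dist_eq_norm, lt_div_iff₀ (by positivity)] at h3
    have h4 : M * ‖u k - u m‖ ≤ |M| * ‖u k - u m‖ :=
      mul_le_mul_of_nonneg_right (le_abs_self M) (norm_nonneg _)
    nlinarith [norm_nonneg (u k - u m)]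
  have hlim : ∀ z, ∃ D, Tendsto (fun k => fderiv ℂ (u k).1 z) atTop (𝓝 D) := fun z =>
    cauchySeq_tendsto_of_complete ((key {z} isCompact_singleton).cauchySeq rfl)
  choose D hD using hlim
  have hloc : TendstoLocallyUniformlyOn (fun k => fderiv ℂ (u k).1) D atTop Set.univ := by
    rw [tendstoLocallyUniformlyOn_iff_forall_isCompact isOpen_univ]
    intro K _ hK
    exact (key K hK).tendstoUniformlyOn_of_tendsto fun z _ => hD z
  intro z
  exact (hasFDerivAt_of_tendstoLocallyUniformlyOn isOpen_univ hloc
    (fun k x _ => ((u k).2.1 x).hasFDerivAt) (fun x _ => hF x) (Set.mem_univ z)).differentiableAt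

/-- The pointwise limit is holomorphic, and it agrees almost everywhere with the `L^p` limit, since
a subsequence of the latter converges almost everywhere. -/
instance instCompleteSpace : CompleteSpace (FockSpace n p t) := by
  refine Metric.complete_of_cauchySeq_tendsto fun u hu => ?_
  have hlim : ∀ w, ∃ c, Tendsto (fun k => u k w) atTop (𝓝 c) := fun w =>
    cauchySeq_tendsto_of_complete (hu.map (evalCLM w).uniformContinuous)
  choose F hF using hlim
  have hcau : CauchySeq fun k => fockToLp n p t (u k) :=
    hu.map (isometry_fockToLp (n := n) (p := p) (t := t)).uniformContinuous
  obtain ⟨G, hG⟩ := cauchySeq_tendsto_of_complete hcau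
  have hGF : G =ᵐ[gaussMeasure n (2 * t / p)] F := by
    obtain ⟨ns, hns, hae⟩ := (tendstoInMeasure_of_tendsto_Lp hG).exists_seq_tendsto_ae
    have hco : ∀ᵐ w ∂gaussMeasure n (2 * t / p), ∀ k, fockToLp n p t (u k) w = u k w :=
      ae_all_iff.2 fun k => MemLp.coeFn_toLp (u k).2.2
    filter_upwards [hae, hco] with w hw hc
    refine tendsto_nhds_unique hw ?_
    simp only [hc]
    exact (hF w).comp hns.tendsto_atTop
  have hmem : MemLp F (ENNReal.ofReal p) (gaussMeasure n (2 * t / p)) :=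
    (memLp_congr_ae hGF).1 (Lp.memLp G)
  let f : FockSpace n p t := ⟨F, differentiable_of_tendsto hu hF, hmem⟩
  refine ⟨f, isometry_fockToLp.isUniformInducing.isInducing.tendsto_nhds_iff.2 ?_⟩
  have : fockToLp n p t f = G := Lp.ext ((MemLp.coeFn_toLp hmem).trans hGF.symm)
  rw [this]
  exact hG

/-! ### Continuity of Weyl operators and of evaluation -/

theorem continuous_nkernel_left (w : Fin n → ℂ) : Continuous fun z => nkernel t z w := by
  have := continuous_sqNorm (n := n)
  unfold nkernel hdot
  fun_prop

theorem continuous_weyl (f : FockSpace n p t) : Continuous fun z => weyl z f := by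
  have hp0 : 0 < p := by linarith [hp.out]
  rw [continuous_iff_continuousAt]
  intro z₀
  refine tendsto_of_seq_tendsto fun u hu => ?_
  rw [tendsto_iff_norm_sub_tendsto_zero]
  have hc : ∀ z, Measurable (weyl z f).1 := fun z => (weyl z f).2.1.continuous.measurable
  have hpow : ∀ g : FockSpace n p t, ∫⁻ w, ‖g w‖ₑ ^ p ∂gaussMeasure n (2 * t / p) =
      (eLpNorm g.1 (ENNReal.ofReal p) (gaussMeasure n (2 * t / p))) ^ p := by
    intro g
    rw [eLpNorm_eq_lintegral_rpow_enorm_toReal (by simpa using hp0) ENNReal.ofReal_ne_top,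
      ENNReal.toReal_ofReal hp0.le, ← ENNReal.rpow_mul, one_div_mul_cancel hp0.ne',
      ENNReal.rpow_one]
  have h := tendsto_lintegral_enorm_sub_rpow (μ := gaussMeasure n (2 * t / p)) (q := p) hp0
    (a := fun k => (weyl (u k) f).1) (b := (weyl z₀ f).1) (fun k => hc _) (hc _)
    (fun w => by
      simp only [weyl_apply]
      have h1 := (continuous_nkernel_left (t := t) w).continuousAt.tendsto.comp hu
      have h2 : Tendsto (fun k => f (w - u k)) atTop (𝓝 (f (w - z₀))) :=
        (f.2.1.continuous.tendsto _).comp (tendsto_const_nhds.sub hu)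
      exact h1.mul h2)
    (by rw [hpow]; exact ENNReal.rpow_ne_top_of_nonneg hp0.le (weyl z₀ f).2.2.2.ne)
    (fun k => by
      rw [hpow, hpow]
      exact congrArg (· ^ p) ((eLpNorm_weyl (u k) f.1).trans (eLpNorm_weyl z₀ f.1).symm))
  have h' := (ENNReal.continuous_rpow_const (y := 1 / p)).continuousAt.tendsto.comp h
  have h'' := (ENNReal.tendsto_toReal (by
    rw [ENNReal.zero_rpow_of_pos (by positivity)]; simp)).comp h'
  rw [ENNReal.zero_rpow_of_pos (by positivity), ENNReal.toReal_zero] at h''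
  refine h''.congr fun k => ?_
  rw [norm_def, eLpNorm_eq_lintegral_rpow_enorm_toReal (by simpa using hp0) ENNReal.ofReal_ne_top,
      ENNReal.toReal_ofReal hp0.le]
  rfl

theorem continuous_weyl_apply {T : Type*} [TopologicalSpace T] {z : T → Fin n → ℂ}
    {f : T → FockSpace n p t} (hz : Continuous z) (hf : Continuous f) :
    Continuous fun a => weyl (z a) (f a) := by
  rw [continuous_iff_continuousAt]
  intro a₀
  rw [ContinuousAt, tendsto_iff_norm_sub_tendsto_zero]
  have h1 : Tendsto (fun a => ‖f a - f a₀‖) (𝓝 a₀) (𝓝 0) :=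
    tendsto_iff_norm_sub_tendsto_zero.1 (hf.tendsto a₀)
  have h2 : Tendsto (fun a => ‖weyl (z a) (f a₀) - weyl (z a₀) (f a₀)‖) (𝓝 a₀) (𝓝 0) :=
    tendsto_iff_norm_sub_tendsto_zero.1 (((continuous_weyl (f a₀)).comp hz).tendsto a₀)
  refine squeeze_zero (fun _ => norm_nonneg _) (fun a => ?_) (by simpa using h1.add h2)
  have : weyl (z a) (f a) - weyl (z a₀) (f a₀) =
      weyl (z a) (f a - f a₀) + (weyl (z a) (f a₀) - weyl (z a₀) (f a₀)) := by
    rw [map_sub]; abel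
  rw [this]
  exact (norm_add_le _ _).trans (by rw [norm_weyl])

/-- Evaluation at a moving point is, up to a continuous factor, evaluation at the fixed point `0` of
`W_{-w} f`. -/
theorem continuous_eval {T : Type*} [TopologicalSpace T] {w : T → Fin n → ℂ}
    {f : T → FockSpace n p t} (hw : Continuous w) (hf : Continuous f) :
    Continuous fun a => f a (w a) := by
  have h : ∀ a, f a (w a) = ((Real.exp (sqNorm (w a) / (2 * t)) : ℝ) : ℂ) *
      evalCLM 0 (weyl (-w a) (f a)) := by
    intro a
    rw [evalCLM_apply, weyl_apply, nkernel, hdot_zero_left, sqNorm_neg, zero_sub, neg_neg,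
      ← mul_assoc, Complex.ofReal_exp, ← Complex.exp_add]
    simp
  simp only [h]
  have h1 := (evalCLM (p := p) (t := t) (0 : Fin n → ℂ)).continuous.comp
    (continuous_weyl_apply hw.neg hf)
  have h2 := (continuous_sqNorm (n := n)).comp hw
  refine Continuous.mul ?_ h1
  exact Complex.continuous_ofReal.comp (Real.continuous_exp.comp (h2.div_const _))

end Space

/-! ### Gaussians as an approximate identity -/

theorem integrable_gauss (n : ℕ) {s : ℝ} (hs : 0 < s) : Integrable (gauss n s) := by
  by_contra h
  have := integral_undef h
  rw [integral_gauss n hs] at this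
  exact one_ne_zero this

theorem integrable_gauss_complex (n : ℕ) {s : ℝ} (hs : 0 < s) :
    Integrable (fun z => ((gauss n s z : ℝ) : ℂ)) := (integrable_gauss n hs).ofReal

section Bochner

variable {n : ℕ} {E : Type*} [NormedAddCommGroup E] [NormedSpace ℂ E]

theorem integrable_smul_of_bounded {g : (Fin n → ℂ) → ℂ} (hg : Integrable g)
    {F : (Fin n → ℂ) → E} (hF : Continuous F) {M : ℝ} (hM : ∀ z, ‖F z‖ ≤ M) :
    Integrable fun z => g z • F z := by
  refine (hg.norm.mul_const M).mono' (hg.1.smul hF.aestronglyMeasurable) ?_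
  refine Eventually.of_forall fun z => ?_
  rw [norm_smul]
  exact mul_le_mul_of_nonneg_left (hM z) (norm_nonneg _)

theorem norm_integral_smul_le {g : (Fin n → ℂ) → ℂ} (hg : Integrable g)
    {F : (Fin n → ℂ) → E} {M : ℝ} (hM : ∀ z, ‖F z‖ ≤ M) :
    ‖∫ z, g z • F z‖ ≤ (∫ z, ‖g z‖) * M := by
  rw [← integral_mul_const]
  refine norm_integral_le_of_norm_le (hg.norm.mul_const M) (Eventually.of_forall fun z => ?_)
  rw [norm_smul]
  exact mul_le_mul_of_nonneg_left (hM z) (norm_nonneg _)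

theorem integral_gauss_smul_scale {s : ℝ} (hs : 0 < s) (F : (Fin n → ℂ) → E) :
    ∫ z, ((gauss n s z : ℝ) : ℂ) • F z =
      ∫ u, ((gauss n 1 u : ℝ) : ℂ) • F ((Real.sqrt s) • u) := by
  have h := Measure.integral_comp_smul (volume : Measure (Fin n → ℂ))
    (fun z => ((gauss n s z : ℝ) : ℂ) • F z) (Real.sqrt s)
  have hf : Module.finrank ℝ (Fin n → ℂ) = 2 * n := by
    rw [Module.finrank_pi_fintype]; simp [mul_comm]
  have hpow : (Real.sqrt s) ^ (2 * n) = s ^ n := by rw [pow_mul, Real.sq_sqrt hs.le]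
  rw [hf, hpow, abs_of_pos (by positivity)] at h
  have hg : ∀ u : Fin n → ℂ, gauss n 1 u = s ^ n * gauss n s (Real.sqrt s • u) := by
    intro u
    have hsq : sqNorm (Real.sqrt s • u) = s * sqNorm u := by
      simp only [sqNorm, Finset.mul_sum]
      refine Finset.sum_congr rfl fun i _ => ?_
      rw [Pi.smul_apply, norm_smul, mul_pow, Real.norm_eq_abs, sq_abs, Real.sq_sqrt hs.le]
    unfold gauss
    rw [hsq, mul_pow, mul_pow]
    have : -(s * sqNorm u) / s = -sqNorm u / 1 := by field_simp
    rw [this]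
    field_simp
    simp
  calc ∫ z, ((gauss n s z : ℝ) : ℂ) • F z
      = (s ^ n : ℝ) • ∫ u, ((gauss n s (Real.sqrt s • u) : ℝ) : ℂ) • F ((Real.sqrt s) • u) := by
        rw [h, smul_smul, mul_inv_cancel₀ (by positivity), one_smul]
    _ = _ := by
        rw [← integral_smul]
        refine integral_congr_ae (Eventually.of_forall fun u => ?_)
        simp only [hg u]
        rw [Complex.ofReal_mul, mul_smul]
        simp only [Complex.coe_smul]

/-- After the substitution `z = √s u` the Gaussian no longer depends on `s`, and dominated
convergence applies. -/
theorem tendsto_integral_gauss_smul [CompleteSpace E] {F : (Fin n → ℂ) → E} (hF : Continuous F)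
    {M : ℝ} (hM : ∀ z, ‖F z‖ ≤ M) :
    Tendsto (fun s : ℝ => ∫ z, ((gauss n s z : ℝ) : ℂ) • F z) (𝓝[>] 0) (𝓝 (F 0)) := by
  have h1 : F 0 = ∫ u, ((gauss n 1 u : ℝ) : ℂ) • F 0 := by
    rw [integral_smul_const, integral_complex_ofReal, integral_gauss n one_pos]; simp
  rw [h1]
  have hev : ∀ᶠ s : ℝ in 𝓝[>] 0, ∫ u, ((gauss n 1 u : ℝ) : ℂ) • F ((Real.sqrt s) • u) =
      ∫ z, ((gauss n s z : ℝ) : ℂ) • F z := by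
    filter_upwards [self_mem_nhdsWithin] with s hs
    exact (integral_gauss_smul_scale hs F).symm
  refine Tendsto.congr' hev ?_
  refine tendsto_integral_filter_of_dominated_convergence (fun u => gauss n 1 u * M) ?_ ?_ ?_ ?_
  · refine Eventually.of_forall fun s => ?_
    exact (integrable_gauss_complex n one_pos).1.smul
      (hF.comp (by fun_prop)).aestronglyMeasurable
  · refine Eventually.of_forall fun s => Eventually.of_forall fun u => ?_
    rw [norm_smul, Complex.norm_real, Real.norm_of_nonneg (gauss_pos n one_pos u).le]
    exact mul_le_mul_of_nonneg_left (hM _) (gauss_pos n one_pos u).le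
  · exact (integrable_gauss n one_pos).mul_const M
  · refine Eventually.of_forall fun u => Tendsto.const_smul ?_ _
    have hc : Continuous fun s : ℝ => F ((Real.sqrt s) • u) :=
      hF.comp (by fun_prop)
    have := hc.tendsto 0
    simp only [Real.sqrt_zero, zero_smul] at this
    exact this.mono_left nhdsWithin_le_nhds

end Bochner

/-! ### Isometric actions of `ℂⁿ` -/

/-- The space `L¹(ℂⁿ)`. -/
abbrev L1 (n : ℕ) : Type := Lp ℂ 1 (volume : Measure (Fin n → ℂ))

/-- An action of the group `ℂⁿ` on a normed space by linear contractions. -/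
structure IsIsometricAction {n : ℕ} {E : Type*} [NormedAddCommGroup E] [NormedSpace ℂ E]
    (α : (Fin n → ℂ) → E →L[ℂ] E) : Prop where
  norm_le : ∀ z x, ‖α z x‖ ≤ ‖x‖
  zero : ∀ x, α 0 x = x
  add : ∀ z w x, α (z + w) x = α z (α w x)

section Action

variable {n : ℕ} {E : Type*} [NormedAddCommGroup E] [NormedSpace ℂ E]
  {α : (Fin n → ℂ) → E →L[ℂ] E}

theorem IsIsometricAction.comm (hα : IsIsometricAction α) (z w : Fin n → ℂ) (x : E) :
    α z (α w x) = α w (α z x) := by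
  rw [← hα.add, ← hα.add, add_comm]

/-- The vectors with norm continuous orbit. -/
def contVec (α : (Fin n → ℂ) → E →L[ℂ] E) : Submodule ℂ E where
  carrier := {x | Continuous fun z => α z x}
  add_mem' hx hy := by
    simp only [Set.mem_ofPred_eq, map_add] at *
    exact hx.add hy
  zero_mem' := by simpa using continuous_const
  smul_mem' c x hx := by
    simp only [Set.mem_ofPred_eq, map_smul] at *
    exact hx.const_smul c

/-- The action is contractive, so close vectors have uniformly close orbits. -/
theorem isClosed_contVec (hα : IsIsometricAction α) : IsClosed (contVec α : Set E) := by
  refine isClosed_of_closure_subset fun x hx => ?_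
  refine continuous_of_uniform_approx_of_continuous fun U hU => ?_
  obtain ⟨ε, hε, hεU⟩ := Metric.mem_uniformity_dist.1 hU
  obtain ⟨y, hy, hxy⟩ := Metric.mem_closure_iff.1 hx ε hε
  refine ⟨fun z => α z y, hy, fun z => hεU ?_⟩
  rw [dist_eq_norm, ← map_sub]
  exact (hα.norm_le z _).trans_lt (by rw [← dist_eq_norm]; exact hxy)

theorem L1.integrable (g : L1 n) : Integrable g := L1.integrable_coeFn g

/-- The convolution `g ∗ x = ∫ g(z) α_z(x) dz` for a strongly continuous isometric action. -/
def convL (hα : IsIsometricAction α) (hc : ∀ x, Continuous fun z => α z x) :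
    L1 n →L[ℂ] E →L[ℂ] E :=
  LinearMap.mkContinuous₂
    (LinearMap.mk₂ ℂ (fun (g : L1 n) (x : E) => ∫ z, g z • α z x)
      (fun g g' x => by
        have h := fun g : L1 n =>
          integrable_smul_of_bounded (L1.integrable g) (hc x) (fun z => hα.norm_le z x)
        rw [← integral_add (h g) (h g')]
        refine integral_congr_ae ?_
        filter_upwards [Lp.coeFn_add g g'] with z hz
        rw [hz, Pi.add_apply, add_smul])
      (fun c g x => by
        rw [← integral_smul]
        refine integral_congr_ae ?_
        filter_upwards [Lp.coeFn_smul c g] with z hz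
        rw [hz, Pi.smul_apply, smul_assoc])
      (fun g x x' => by
        have h := fun x =>
          integrable_smul_of_bounded (L1.integrable g) (hc x) (fun z => hα.norm_le z x)
        rw [← integral_add (h x) (h x')]
        simp only [map_add, smul_add])
      (fun c g x => by
        rw [← integral_smul]
        simp only [map_smul, smul_comm c]))
    1 (fun g x => by
      rw [one_mul, L1.norm_eq_integral_norm]
      exact norm_integral_smul_le (L1.integrable g) fun z => hα.norm_le z x)

variable (hα : IsIsometricAction α) (hc : ∀ x, Continuous fun z => α z x)

theorem convL_apply (g : L1 n) (x : E) : convL hα hc g x = ∫ z, g z • α z x := rfl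

theorem norm_convL_le (g : L1 n) (x : E) : ‖convL hα hc g x‖ ≤ ‖g‖ * ‖x‖ := by
  rw [convL_apply, L1.norm_eq_integral_norm]
  exact norm_integral_smul_le (L1.integrable g) fun z => hα.norm_le z x

theorem convL_commute [CompleteSpace E] {B : E →L[ℂ] E} (hB : ∀ z x, B (α z x) = α z (B x))
    (g : L1 n) (x : E) : B (convL hα hc g x) = convL hα hc g (B x) := by
  rw [convL_apply, convL_apply, ← ContinuousLinearMap.integral_comp_comm B
    (integrable_smul_of_bounded (L1.integrable g) (hc x) (fun z => hα.norm_le z x))]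
  simp only [map_smul, hB]

/-- Translation on `L¹(ℂⁿ)`. -/
def transL1 (w : Fin n → ℂ) : L1 n →L[ℂ] L1 n :=
  (Lp.compMeasurePreservingₗᵢ ℂ (fun z => z - w)
    (measurePreserving_sub_right volume w)).toContinuousLinearMap

theorem coeFn_transL1 (w : Fin n → ℂ) (g : L1 n) :
    transL1 w g =ᵐ[volume] fun z => g (z - w) :=
  Lp.coeFn_compMeasurePreserving g (measurePreserving_sub_right volume w)

theorem ae_comp_sub {q : (Fin n → ℂ) → Prop} (w : Fin n → ℂ) (h : ∀ᵐ z, q z) :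
    ∀ᵐ z, q (z - w) :=
  (measurePreserving_sub_right volume w).quasiMeasurePreserving.ae h

theorem isIsometricAction_transL1 : IsIsometricAction (transL1 (n := n)) where
  norm_le w g := (LinearIsometry.norm_map _ g).le
  zero g := Lp.ext ((coeFn_transL1 0 g).trans (by simp))
  add z w g := by
    refine Lp.ext ((coeFn_transL1 _ g).trans ?_)
    filter_upwards [coeFn_transL1 z (transL1 w g), ae_comp_sub z (coeFn_transL1 w g)] with u h1 h2
    rw [h1, h2, sub_sub]

theorem continuous_transL1 (g : L1 n) : Continuous fun w => transL1 w g := by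
  have h : Continuous fun w : Fin n → ℂ => (⟨fun z => z - w, by fun_prop⟩ : C(Fin n → ℂ, Fin n → ℂ)) :=
    ContinuousMap.continuous_of_continuous_uncurry _ (by
      simp only [Function.uncurry_def, ContinuousMap.coe_mk]; fun_prop)
  exact Continuous.compMeasurePreservingLp (continuous_const (y := g)) h
    (fun w => measurePreserving_sub_right volume w) (by simp)

theorem convL_transL1 [CompleteSpace E] (w : Fin n → ℂ) (g : L1 n) (x : E) :
    convL hα hc (transL1 w g) x = α w (convL hα hc g x) := by
  rw [convL_commute hα hc (fun z x => hα.comm w z x)]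
  rw [convL_apply, convL_apply]
  rw [integral_congr_ae (g := fun z => g (z - w) • α z x) (by
    filter_upwards [coeFn_transL1 w g] with z hz; rw [hz])]
  rw [← integral_add_right_eq_self (fun z => g (z - w) • α z x) w]
  simp only [add_sub_cancel_right, hα.add]

/-- Makes `E` a module over the convolution algebra: the bounded map `g ↦ g ∗ x` passes under the
integral `∫ f(z) g(· - z) dz` in `L¹`, and translates of `g` become `α_z` outside. -/
theorem convL_convL [CompleteSpace E] (f g : L1 n) (x : E) :
    convL hα hc (convL isIsometricAction_transL1 continuous_transL1 f g) x =
      convL hα hc f (convL hα hc g x) := by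
  have h := ContinuousLinearMap.integral_comp_comm ((convL hα hc).flip x)
    (integrable_smul_of_bounded (L1.integrable f) (continuous_transL1 g)
      (fun z => isIsometricAction_transL1.norm_le z g))
  refine h.symm.trans ?_
  rw [convL_apply hα hc f]
  simp only [map_smul, ContinuousLinearMap.flip_apply, convL_transL1]

/-- The Gaussian `f_s` as an element of `L¹(ℂⁿ)`. -/
def gaussL1 (n : ℕ) {s : ℝ} (hs : 0 < s) : L1 n := (integrable_gauss_complex n hs).toL1 _

theorem norm_gaussL1_le {s : ℝ} (hs : 0 < s) : ‖gaussL1 n hs‖ ≤ 1 := by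
  rw [gaussL1, L1.norm_of_fun_eq_integral_norm]
  simp only [Complex.norm_real]
  simp only [Real.norm_of_nonneg (gauss_pos n hs _).le, integral_gauss n hs, le_refl]

theorem convL_toL1 {g : (Fin n → ℂ) → ℂ} (hg : Integrable g) (x : E) :
    convL hα hc (hg.toL1 g) x = ∫ z, g z • α z x := by
  rw [convL_apply]
  refine integral_congr_ae ?_
  filter_upwards [hg.coeFn_toL1] with z hz
  rw [hz]

theorem eventually_norm_sub_convL_gauss_le [CompleteSpace E] (x : E) {ε : ℝ} (hε : 0 < ε) :
    ∀ᶠ s : ℝ in 𝓝[>] 0, ∀ hs : 0 < s, ‖x - convL hα hc (gaussL1 n hs) x‖ ≤ ε := by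
  have h := tendsto_integral_gauss_smul (hc x) (fun z => hα.norm_le z x)
  rw [hα.zero] at h
  filter_upwards [h (Metric.ball_mem_nhds x hε)] with s hs hs0
  rw [gaussL1, convL_toL1]
  have : dist _ x < ε := hs
  rw [dist_comm, dist_eq_norm] at this
  exact this.le

/-! ### Factorization -/

/-- Neumann series: `2 - T = 2 (1 - T / 2)` with `‖T / 2‖ < 1`. -/
theorem exists_two_sub_apply_eq [CompleteSpace E] {T : E →L[ℂ] E} (hT : ‖T‖ ≤ 1) (h : E) :
    ∃ h', (2 : ℂ) • h' - T h' = h := by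
  have hlt : ‖(1 / 2 : ℂ) • T‖ < 1 := by
    rw [norm_smul]; norm_num; linarith
  obtain ⟨u, hu⟩ := isUnit_one_sub_of_norm_lt_one hlt
  refine ⟨(1 / 2 : ℂ) • (↑u⁻¹ : E →L[ℂ] E) h, ?_⟩
  have h1 : (u : E →L[ℂ] E) ((↑u⁻¹ : E →L[ℂ] E) h) = h := by
    exact DFunLike.congr_fun u.mul_inv h
  rw [hu] at h1
  rw [smul_smul, map_smul]
  norm_num
  simpa using h1

theorem norm_le_norm_two_sub {T : E →L[ℂ] E} (hT : ‖T‖ ≤ 1) (h : E) :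
    ‖h‖ ≤ ‖(2 : ℂ) • h - T h‖ := by
  have h1 : ‖T h‖ ≤ ‖h‖ := T.le_of_opNorm_le_of_le hT le_rfl |>.trans (by simp)
  have h2 : ‖(2 : ℂ) • h‖ = 2 * ‖h‖ := by rw [norm_smul]; norm_num
  have := norm_sub_norm_le ((2 : ℂ) • h) (T h)
  linarith

/-- The step of Cohen's construction. With a unit `δ` adjoined to `L¹`, the hypothesis reads `x =
(2^{-N} δ + h) ∗ y`. Put `y' = (2δ - f_s) ∗ y` and divide the other factor by `2δ - f_s`. For small
`s` both `y` and `h` move by a multiple of `2^{-N}` only, while the coefficient of `δ` is halved. -/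
theorem exists_factor_step [CompleteSpace E] {x y : E} {h : L1 n} (N : ℕ)
    (hx : x = ((1 / 2 : ℂ) ^ N) • y + convL hα hc h y) :
    ∃ (y' : E) (h' : L1 n), x = ((1 / 2 : ℂ) ^ (N + 1)) • y' + convL hα hc h' y' ∧
      ‖y - y'‖ ≤ 2 * (1 / 2 : ℝ) ^ N ∧ ‖h - h'‖ ≤ 2 * (1 / 2 : ℝ) ^ N := by
  have hε : 0 < (1 / 2 : ℝ) ^ N := by positivity
  obtain ⟨s, ⟨h1, h2⟩, hs⟩ := ((eventually_norm_sub_convL_gauss_le hα hc y hε).and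
    (eventually_norm_sub_convL_gauss_le isIsometricAction_transL1 continuous_transL1 h hε)
      |>.and self_mem_nhdsWithin).exists
  have hs : 0 < s := hs
  specialize h1 hs
  specialize h2 hs
  set T := convL hα hc (gaussL1 n hs) with hT
  set τ := convL isIsometricAction_transL1 continuous_transL1 (gaussL1 n hs) with hτ
  have hτ1 : ‖τ‖ ≤ 1 := by
    refine ContinuousLinearMap.opNorm_le_bound _ zero_le_one fun g => ?_
    exact (norm_convL_le _ _ _ g).trans
      (mul_le_mul_of_nonneg_right (norm_gaussL1_le hs) (norm_nonneg _))
  -- This is the `L¹` part of `(2δ - f_s) ∗ (2^{-N-1} δ + h') = 2^{-N} δ + h`.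
  obtain ⟨h', hh'⟩ := exists_two_sub_apply_eq hτ1 (h + ((1 / 2 : ℂ) ^ (N + 1)) • gaussL1 n hs)
  refine ⟨(2 : ℂ) • y - T y, h', ?_, ?_, ?_⟩
  · have hcomm : ∀ g : L1 n, convL hα hc g (T y) = T (convL hα hc g y) := fun g =>
      convL_commute hα hc (B := convL hα hc g)
        (fun z x => (convL_commute hα hc (fun z' x' => hα.comm z z' x') g x).symm) _ y
    have e1 : convL hα hc h' ((2 : ℂ) • y - T y) = convL hα hc ((2 : ℂ) • h' - τ h') y := by
      rw [map_sub, map_smul, hcomm, map_sub, map_smul, _root_.sub_apply,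
        _root_.smul_apply, hτ, convL_convL]
    rw [e1, hh', map_add, map_smul, _root_.add_apply, _root_.smul_apply,
      ← hT, hx, pow_succ]
    module
  · have : y - ((2 : ℂ) • y - T y) = -(y - T y) := by module
    rw [this, norm_neg]
    linarith
  · refine (norm_le_norm_two_sub hτ1 _).trans ?_
    have : (2 : ℂ) • (h - h') - τ (h - h') = (h - τ h) - ((1 / 2 : ℂ) ^ (N + 1)) • gaussL1 n hs := by
      rw [map_sub, smul_sub, sub_sub_sub_comm, hh']
      module
    rw [this]
    refine (norm_sub_le _ _).trans ?_
    have h3 : ‖((1 / 2 : ℂ) ^ (N + 1)) • gaussL1 n hs‖ ≤ (1 / 2 : ℝ) ^ (N + 1) := by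
      rw [norm_smul, norm_pow]
      norm_num
      exact norm_gaussL1_le hs
    have h4 : (1 / 2 : ℝ) ^ (N + 1) = (1 / 2) ^ N * (1 / 2) := pow_succ _ _
    linarith

theorem exists_seq_of_step {β : Type*} {P : ℕ → β → Prop} {R : ℕ → β → β → Prop} {b : β}
    (hb : P 0 b) (hs : ∀ N b, P N b → ∃ b', P (N + 1) b' ∧ R N b b') :
    ∃ s : ℕ → β, ∀ N, P N (s N) ∧ R N (s N) (s (N + 1)) := by
  choose next hP hR using hs
  let seq : (N : ℕ) → {q // P N q} := fun N =>
    Nat.rec (motive := fun N => {q // P N q}) ⟨b, hb⟩ (fun N q => ⟨next N q.1 q.2, hP N q.1 q.2⟩) N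
  exact ⟨fun N => (seq N).1, fun N => ⟨(seq N).2, hR N (seq N).1 (seq N).2⟩⟩

/-- Cohen's factorization theorem for strongly continuous isometric actions of `ℂⁿ`. -/
theorem exists_convL_eq [CompleteSpace E] (x : E) : ∃ (g : L1 n) (y : E), convL hα hc g y = x := by
  obtain ⟨s, hs⟩ := exists_seq_of_step (β := E × L1 n)
    (P := fun N q => x = ((1 / 2 : ℂ) ^ N) • q.1 + convL hα hc q.2 q.1)
    (R := fun N q q' => ‖q.1 - q'.1‖ ≤ 2 * (1 / 2 : ℝ) ^ N ∧ ‖q.2 - q'.2‖ ≤ 2 * (1 / 2 : ℝ) ^ N)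
    (b := (x, 0)) (by rw [map_zero]; simp) (by
      rintro N ⟨y, h⟩ hq
      obtain ⟨y', h', h1, h2⟩ := exists_factor_step hα hc N hq
      exact ⟨(y', h'), h1, h2⟩)
  have hy : CauchySeq fun N => (s N).1 :=
    cauchySeq_of_le_geometric (1 / 2) 2 (by norm_num) fun N => by
      rw [dist_eq_norm]; exact (hs N).2.1
  have hh : CauchySeq fun N => (s N).2 :=
    cauchySeq_of_le_geometric (1 / 2) 2 (by norm_num) fun N => by
      rw [dist_eq_norm]; exact (hs N).2.2
  obtain ⟨y, hy⟩ := cauchySeq_tendsto_of_complete hy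
  obtain ⟨h, hh⟩ := cauchySeq_tendsto_of_complete hh
  refine ⟨h, y, ?_⟩
  have h1 : Tendsto (fun N => convL hα hc (s N).2 (s N).1) atTop (𝓝 (convL hα hc h y)) := by
    have hcont : Continuous fun q : L1 n × E => convL hα hc q.1 q.2 :=
      ((convL hα hc).continuous.comp continuous_fst).clm_apply continuous_snd
    have h5 := (hcont.tendsto (h, y)).comp (hh.prodMk_nhds hy)
    exact h5
  -- The vectors `(s N).1` converge, so the contribution of the adjoined unit disappears and an
  -- honest `L¹` factor remains.
  have h2 : Tendsto (fun N => ((1 / 2 : ℂ) ^ N) • (s N).1) atTop (𝓝 0) := by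
    have h3 : Tendsto (fun N : ℕ => (1 / 2 : ℂ) ^ N) atTop (𝓝 0) :=
      tendsto_pow_atTop_nhds_zero_of_norm_lt_one (by norm_num)
    simpa using h3.smul hy
  have h4 := h2.add h1
  rw [zero_add] at h4
  exact tendsto_nhds_unique h4 (tendsto_const_nhds.congr fun N => (hs N).1)

end Action

/-! ### Termwise integration of series -/

theorem integrable_tsum_of_summable_integral_norm {X : Type*} [MeasurableSpace X] {μ : Measure X}
    {F : ℕ → X → ℂ} (hm : AEStronglyMeasurable (fun x => ∑' j, F j x) μ)
    (hF : ∀ j, Integrable (F j) μ) (hs : Summable fun j => ∫ x, ‖F j x‖ ∂μ) :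
    Integrable (fun x => ∑' j, F j x) μ := by
  refine ⟨hm, ?_⟩
  have h1 : ∫⁻ x, ∑' j, ‖F j x‖ₑ ∂μ < ∞ := by
    rw [lintegral_tsum fun j => (hF j).1.enorm]
    have h2 : ∀ j, ∫⁻ x, ‖F j x‖ₑ ∂μ = ENNReal.ofReal (∫ x, ‖F j x‖ ∂μ) := fun j =>
      (ofReal_integral_norm_eq_lintegral_enorm (hF j)).symm
    simp only [h2]
    rw [← ENNReal.ofReal_tsum_of_nonneg (fun j => integral_nonneg fun x => norm_nonneg _) hs]
    exact ENNReal.ofReal_lt_top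
  exact (lintegral_mono fun x => enorm_tsum_le_tsum_enorm).trans_lt h1

section Space

variable {n : ℕ} {p t : ℝ} [hp : Fact (1 < p)] [ht : Fact (0 < t)]

/-- The bounded operators on `F_t^p`. -/
abbrev BOp (n : ℕ) (p t : ℝ) [Fact (1 < p)] [Fact (0 < t)] : Type :=
  FockSpace n p t →L[ℂ] FockSpace n p t

/-! ### The action by shifts -/

theorem hdot_comm_im (z w : Fin n → ℂ) : (hdot w z).im = -(hdot z w).im := by
  unfold hdot
  rw [Complex.im_sum, Complex.im_sum, ← Finset.sum_neg_distrib]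
  refine Finset.sum_congr rfl fun i _ => ?_
  simp only [Complex.mul_im, Complex.conj_re, Complex.conj_im]
  ring

theorem hdot_add_right (w z z' : Fin n → ℂ) : hdot w (z + z') = hdot w z + hdot w z' := by
  simp [hdot, mul_add, Finset.sum_add_distrib]

theorem hdot_sub_left (w w' z : Fin n → ℂ) : hdot (w - w') z = hdot w z - hdot w' z := by
  simp [hdot, sub_mul, Finset.sum_sub_distrib]

theorem hdot_neg_right (w z : Fin n → ℂ) : hdot w (-z) = -hdot w z := by simp [hdot]

theorem hdot_neg_left (w z : Fin n → ℂ) : hdot (-w) z = -hdot w z := by simp [hdot]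

theorem hdot_self (z : Fin n → ℂ) : hdot z z = ((sqNorm z : ℝ) : ℂ) := by
  unfold hdot sqNorm
  rw [Complex.ofReal_sum]
  refine Finset.sum_congr rfl fun i _ => ?_
  rw [Complex.mul_conj, Complex.normSq_eq_norm_sq]

theorem sqNorm_add (w z : Fin n → ℂ) :
    sqNorm (w + z) = sqNorm w + 2 * (hdot w z).re + sqNorm z := by
  have h := sqNorm_sub w (-z)
  rw [sub_neg_eq_add, hdot_neg_right, sqNorm_neg, Complex.neg_re] at h
  rw [h]; ring

/-- The phase in the Weyl commutation relations. -/
def weylPhase (t : ℝ) (z w : Fin n → ℂ) : ℂ :=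
  Complex.exp (((-(hdot z w).im / t : ℝ) : ℂ) * Complex.I)

/-- The Weyl relation: the exponents of the two kernels differ from that of the product by the
purely imaginary part of `z · w̄`, which cancels in `W_z A W_{-z}`. -/
theorem weyl_weyl (z w : Fin n → ℂ) (f : FockSpace n p t) :
    weyl z (weyl w f) = weylPhase t z w • weyl (z + w) f := by
  have ht0 : (t : ℂ) ≠ 0 := by exact_mod_cast ht.out.ne'
  refine FockSpace.ext fun u => ?_
  change nkernel t z u * (nkernel t w (u - z) * f (u - z - w)) =
    weylPhase t z w * (nkernel t (z + w) u * f (u - (z + w)))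
  rw [sub_sub, ← mul_assoc, ← mul_assoc]
  congr 1
  rw [nkernel, nkernel, nkernel, weylPhase, ← Complex.exp_add, ← Complex.exp_add]
  congr 1
  have h : hdot z w = (((hdot z w).re : ℝ) : ℂ) + (((hdot z w).im : ℝ) : ℂ) * Complex.I :=
    (Complex.re_add_im _).symm
  rw [hdot_sub_left, hdot_add_right, sqNorm_add]
  conv_lhs => rw [h]
  push_cast
  field_simp
  ring

theorem weyl_zero (f : FockSpace n p t) : weyl 0 f = f := by
  refine FockSpace.ext fun u => ?_
  rw [weyl_apply]
  simp [nkernel, hdot, sqNorm]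

theorem shift_apply (z : Fin n → ℂ) (A : BOp n p t) (x : FockSpace n p t) :
    shift z A x = weyl z (A (weyl (-z) x)) := rfl

theorem shift_zero (A : BOp n p t) : shift 0 A = A := by
  ext1 x
  rw [shift_apply, weyl_zero, neg_zero, weyl_zero]

theorem weylPhase_mul (z w : Fin n → ℂ) : weylPhase t (-w) (-z) * weylPhase t z w = 1 := by
  rw [weylPhase, weylPhase, ← Complex.exp_add, hdot_neg_right, hdot_neg_left, neg_neg,
    hdot_comm_im]
  push_cast
  rw [← Complex.exp_zero]
  congr 1
  ring

theorem shift_add (z w : Fin n → ℂ) (A : BOp n p t) :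
    shift (z + w) A = shift z (shift w A) := by
  ext1 x
  rw [shift_apply, shift_apply, shift_apply, weyl_weyl, weyl_weyl, map_smul, map_smul, smul_smul,
    neg_add, add_comm (-w), mul_comm, weylPhase_mul, one_smul]

theorem norm_shift_apply_le (z : Fin n → ℂ) (A : BOp n p t) (x : FockSpace n p t) :
    ‖shift z A x‖ ≤ ‖A‖ * ‖x‖ := by
  rw [shift_apply, norm_weyl]
  exact (A.le_opNorm _).trans (by rw [norm_weyl])

theorem norm_shift_le (z : Fin n → ℂ) (A : BOp n p t) : ‖shift z A‖ ≤ ‖A‖ :=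
  ContinuousLinearMap.opNorm_le_bound _ (norm_nonneg _) (norm_shift_apply_le z A)

/-- The action by shifts as bounded operators on the algebra of bounded operators. -/
def shiftL (z : Fin n → ℂ) : BOp n p t →L[ℂ] BOp n p t :=
  LinearMap.mkContinuous
    { toFun := shift z
      map_add' := fun A B => by ext1 x; simp [shift_apply]
      map_smul' := fun c A => by ext1 x; simp [shift_apply] } 1
    (fun A => by rw [one_mul]; exact norm_shift_le z A)

theorem shiftL_apply (z : Fin n → ℂ) (A : BOp n p t) : shiftL z A = shift z A := rfl

theorem isIsometricAction_shiftL : IsIsometricAction (shiftL (n := n) (p := p) (t := t)) where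
  norm_le := norm_shift_le
  zero := shift_zero
  add := shift_add

theorem continuous_shift_apply (A : BOp n p t) (x : FockSpace n p t) :
    Continuous fun z => shift z A x :=
  continuous_weyl_apply continuous_id (A.continuous.comp ((continuous_weyl x).comp continuous_neg))

/-! ### Weak integrals of operators -/

/-- The weak form of `C = ∫ g(z) α_z(A) dz`, tested on vectors and functionals. -/
def WeakConv (g : (Fin n → ℂ) → ℂ) (A C : BOp n p t) : Prop :=
  ∀ (y : FockSpace n p t →L[ℂ] ℂ) (x : FockSpace n p t),
    Integrable (fun z => g z * y (shift z A x)) volume ∧ y (C x) = ∫ z, g z * y (shift z A x)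

/-- The nuclear operator `y ⊗ x`. -/
def rankOneSeries {X : Type*} [NormedAddCommGroup X] [NormedSpace ℂ X] (y : X →L[ℂ] ℂ) (x : X) :
    NuclearSeries X where
  y j := if j = 0 then y else 0
  x _ := x
  summable := summable_of_ne_finset_zero (s := {0}) fun j hj => by
    rw [if_neg (by simpa using hj)]; simp

theorem trPair_rankOneSeries {X : Type*} [NormedAddCommGroup X] [NormedSpace ℂ X] (A : X →L[ℂ] X)
    (y : X →L[ℂ] ℂ) (x : X) : trPair A (rankOneSeries y x) = y (A x) := by
  rw [trPair, tsum_eq_single 0 (fun j hj => by simp [rankOneSeries, hj])]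
  simp [rankOneSeries]

theorem IsConvFun.weakConv {g : (Fin n → ℂ) → ℂ} {A C : BOp n p t} (h : IsConvFun g A C) :
    WeakConv g A C := fun y x => by
  simpa only [trPair_rankOneSeries] using h (rankOneSeries y x)

theorem ext_dual {A B : BOp n p t}
    (h : ∀ (y : FockSpace n p t →L[ℂ] ℂ) x, y (A x) = y (B x)) : A = B := by
  ext1 x
  refine sub_eq_zero.1 (SeparatingDual.eq_zero_of_forall_dual_eq_zero (R := ℂ) fun y => ?_)
  rw [map_sub, h, sub_self]

theorem WeakConv.unique {g : (Fin n → ℂ) → ℂ} {A C C' : BOp n p t} (h : WeakConv g A C)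
    (h' : WeakConv g A C') : C = C' :=
  ext_dual fun y x => (h y x).2.trans (h' y x).2.symm

theorem norm_le_of_forall_dual {A : BOp n p t} {K : ℝ} (hK : 0 ≤ K)
    (h : ∀ (y : FockSpace n p t →L[ℂ] ℂ) x, ‖y (A x)‖ ≤ K * ‖y‖ * ‖x‖) : ‖A‖ ≤ K := by
  refine A.opNorm_le_bound hK fun x => ?_
  refine NormedSpace.norm_le_dual_bound ℂ _ (by positivity) fun y => ?_
  refine (h y x).trans (le_of_eq ?_)
  ring

theorem norm_dual_shift_le (y : FockSpace n p t →L[ℂ] ℂ) (z : Fin n → ℂ) (A : BOp n p t)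
    (x : FockSpace n p t) : ‖y (shift z A x)‖ ≤ ‖A‖ * (‖y‖ * ‖x‖) := by
  refine (y.le_opNorm _).trans ?_
  refine (mul_le_mul_of_nonneg_left (norm_shift_apply_le z A x) (norm_nonneg y)).trans (le_of_eq ?_)
  ring

theorem continuous_trPair_shift (A : BOp n p t) (N : NuclearSeries (FockSpace n p t)) :
    Continuous fun z => trPair (shift z A) N :=
  continuous_tsum (fun j => (N.y j).continuous.comp (continuous_shift_apply A (N.x j)))
    (N.summable.mul_left ‖A‖) fun _ _ => norm_dual_shift_le _ _ _ _

/-- Rank one tests extend to nuclear ones: the bound `K ‖y‖ ‖x‖` makes the integrals of the terms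
summable along any nuclear series. The bound is a hypothesis because `g` need not be integrable in
the application to `R_t`. -/
theorem WeakConv.isConvFun {g : (Fin n → ℂ) → ℂ} {A C : BOp n p t} (h : WeakConv g A C)
    (hg : AEStronglyMeasurable g volume) {K : ℝ}
    (hK : ∀ (y : FockSpace n p t →L[ℂ] ℂ) x,
      ∫ z, ‖g z * y (shift z A x)‖ ≤ K * (‖y‖ * ‖x‖)) : IsConvFun g A C := by
  intro N
  have hs : Summable fun j => ∫ z, ‖g z * N.y j (shift z A (N.x j))‖ :=
    Summable.of_nonneg_of_le (fun j => integral_nonneg fun z => norm_nonneg _)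
      (fun j => hK (N.y j) (N.x j)) (N.summable.mul_left K)
  have hF := fun j => (h (N.y j) (N.x j)).1
  have e : (fun z => g z * trPair (shift z A) N) =
      fun z => ∑' j, g z * N.y j (shift z A (N.x j)) := by
    funext z
    rw [trPair, tsum_mul_left]
  constructor
  · have hm : AEStronglyMeasurable (fun z => g z * trPair (shift z A) N) volume :=
      hg.mul (continuous_trPair_shift A N).aestronglyMeasurable
    rw [e] at hm ⊢
    exact integrable_tsum_of_summable_integral_norm hm hF hs
  · rw [e, ← (hasSum_integral_of_summable_integral_norm hF hs).tsum_eq, trPair]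
    exact tsum_congr fun j => (h (N.y j) (N.x j)).2

theorem integral_norm_mul_le {g : (Fin n → ℂ) → ℂ} (hg : Integrable g)
    (A : BOp n p t) (y : FockSpace n p t →L[ℂ] ℂ) (x : FockSpace n p t) :
    ∫ z, ‖g z * y (shift z A x)‖ ≤ ((∫ z, ‖g z‖) * ‖A‖) * (‖y‖ * ‖x‖) := by
  rw [mul_assoc, ← integral_mul_const]
  refine integral_mono_of_nonneg (Eventually.of_forall fun z => norm_nonneg _)
    (hg.norm.mul_const _) (Eventually.of_forall fun z => ?_)
  simp only [norm_mul]
  exact mul_le_mul_of_nonneg_left (norm_dual_shift_le y z A x) (norm_nonneg _)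

/-- The strong integral `∫ g(z) α_z(A) dz`. -/
def strongConv (g : (Fin n → ℂ) → ℂ) (hg : Integrable g) (A : BOp n p t) : BOp n p t :=
  have hi := fun x => integrable_smul_of_bounded hg (continuous_shift_apply A x)
    (fun z => norm_shift_apply_le z A x)
  LinearMap.mkContinuous
    { toFun := fun x => ∫ z, g z • shift z A x
      map_add' := fun x x' => by
        rw [← integral_add (hi x) (hi x')]
        simp only [map_add, smul_add]
      map_smul' := fun c x => by
        rw [RingHom.id_apply, ← integral_smul]
        simp only [map_smul, smul_comm c] } ((∫ z, ‖g z‖) * ‖A‖)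
    (fun x => by
      rw [mul_assoc]
      exact norm_integral_smul_le hg (fun z => norm_shift_apply_le z A x))

theorem weakConv_strongConv {g : (Fin n → ℂ) → ℂ} (hg : Integrable g) (A : BOp n p t) :
    WeakConv g A (strongConv g hg A) := by
  intro y x
  have hi := integrable_smul_of_bounded hg (continuous_shift_apply A x)
    (fun z => norm_shift_apply_le z A x)
  have h1 := y.integrable_comp hi
  have h2 := y.integral_comp_comm hi
  simp only [map_smul, smul_eq_mul] at h1 h2
  exact ⟨h1, h2.symm⟩

theorem isConvFun_strongConv {g : (Fin n → ℂ) → ℂ} (hg : Integrable g) (A : BOp n p t) :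
    IsConvFun g A (strongConv g hg A) :=
  (weakConv_strongConv hg A).isConvFun hg.1 (integral_norm_mul_le hg A)

theorem isConvFun_convFun {g : (Fin n → ℂ) → ℂ} {A : BOp n p t} (h : ∃ C, IsConvFun g A C) :
    IsConvFun g A (convFun g A) := by
  rw [convFun, dif_pos h]
  exact h.choose_spec

theorem convFun_eq {g : (Fin n → ℂ) → ℂ} {A C : BOp n p t} (h : IsConvFun g A C) :
    convFun g A = C :=
  (isConvFun_convFun ⟨C, h⟩).weakConv.unique h.weakConv

theorem convFun_eq_strongConv {g : (Fin n → ℂ) → ℂ} (hg : Integrable g) (A : BOp n p t) :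
    convFun g A = strongConv g hg A := convFun_eq (isConvFun_strongConv hg A)

theorem convFun_eq_of_weakConv {g : (Fin n → ℂ) → ℂ} (hg : Integrable g) {A C : BOp n p t}
    (h : WeakConv g A C) : convFun g A = C := by
  rw [convFun_eq_strongConv hg]
  exact (weakConv_strongConv hg A).unique h

theorem weakConv_convFun {g : (Fin n → ℂ) → ℂ} (hg : Integrable g) (A : BOp n p t) :
    WeakConv g A (convFun g A) := by
  rw [convFun_eq_strongConv hg]
  exact weakConv_strongConv hg A

theorem existsUnique_isConvFun {g : (Fin n → ℂ) → ℂ} (hg : Integrable g) (A : BOp n p t) :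
    ∃! C, IsConvFun g A C :=
  ⟨_, isConvFun_strongConv hg A, fun _ h => h.weakConv.unique (weakConv_strongConv hg A)⟩

/-- For `A ∈ C1` the integrand is measurable into the operator norm, so the weak integral is a
Bochner integral. -/
theorem convFun_eq_integral {g : (Fin n → ℂ) → ℂ} (hg : Integrable g) {A : BOp n p t}
    (hA : A ∈ C1 n p t) : convFun g A = ∫ z, g z • shift z A := by
  refine convFun_eq_of_weakConv hg fun y x => ?_
  have hi : Integrable fun z => g z • shift z A :=
    integrable_smul_of_bounded hg hA (fun z => norm_shift_le z A)
  let ℓ : BOp n p t →L[ℂ] ℂ := y.comp (ContinuousLinearMap.apply ℂ _ x)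
  have h1 := ℓ.integrable_comp hi
  have h2 := ℓ.integral_comp_comm hi
  simp only [map_smul, smul_eq_mul] at h1 h2
  exact ⟨h1, h2.symm⟩

/-! ### Convolutions belong to `C₁` -/

/-- Test the given relation on `y ∘ W_w` and `W_{-w} x`, then translate the variable of integration.
-/
theorem WeakConv.shift {g : (Fin n → ℂ) → ℂ} {A C : BOp n p t} (h : WeakConv g A C)
    (w : Fin n → ℂ) : WeakConv (fun z => g (z - w)) A (shift w C) := by
  intro y x
  obtain ⟨h1, h2⟩ := h (y.comp (weyl w)) (weyl (-w) x)
  have e : ∀ z, g z * (y.comp (weyl w)) (PFock.shift z A (weyl (-w) x)) =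
      (fun u => g (u - w) * y (PFock.shift u A x)) (z + w) := by
    intro z
    simp only [add_sub_cancel_right]
    rw [add_comm z w, shift_add]
    rfl
  simp only [e] at h1 h2
  rw [integral_add_right_eq_self (fun u => g (u - w) * y (PFock.shift u A x)) w] at h2
  refine ⟨?_, h2⟩
  have := h1.comp_sub_right w
  simpa only [sub_add_cancel] using this

theorem norm_convFun_le {g : (Fin n → ℂ) → ℂ} (hg : Integrable g) (A : BOp n p t) :
    ‖convFun g A‖ ≤ (∫ z, ‖g z‖) * ‖A‖ := by
  refine norm_le_of_forall_dual
    (mul_nonneg (integral_nonneg fun _ => norm_nonneg _) (norm_nonneg _)) fun y x => ?_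
  rw [((weakConv_convFun hg A) y x).2, mul_assoc _ ‖y‖]
  exact (norm_integral_le_integral_norm _).trans (integral_norm_mul_le hg A y x)

theorem WeakConv.add {g g' : (Fin n → ℂ) → ℂ} {A C C' : BOp n p t} (h : WeakConv g A C)
    (h' : WeakConv g' A C') : WeakConv (fun z => g z + g' z) A (C + C') := by
  intro y x
  simp only [add_mul, _root_.add_apply, map_add]
  exact ⟨(h y x).1.add (h' y x).1, by
    rw [integral_add (h y x).1 (h' y x).1, (h y x).2, (h' y x).2]⟩

theorem WeakConv.smul {g : (Fin n → ℂ) → ℂ} {A C : BOp n p t} (h : WeakConv g A C)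
    (c : ℂ) : WeakConv (fun z => c * g z) A (c • C) := by
  intro y x
  simp only [mul_assoc, _root_.smul_apply, map_smul, smul_eq_mul]
  exact ⟨(h y x).1.const_mul c, by rw [integral_const_mul, (h y x).2]⟩

theorem convFun_congr_ae {g g' : (Fin n → ℂ) → ℂ} (hg : Integrable g) (h : g =ᵐ[volume] g')
    (A : BOp n p t) : convFun g A = convFun g' A := by
  have hg' : Integrable g' := hg.congr h
  refine convFun_eq_of_weakConv hg fun y x => ?_
  have e : (fun z => g z * y (shift z A x)) =ᵐ[volume] fun z => g' z * y (shift z A x) := by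
    filter_upwards [h] with z hz; rw [hz]
  have h2 := weakConv_convFun hg' A y x
  exact ⟨h2.1.congr e.symm, h2.2.trans (integral_congr_ae e.symm)⟩

/-- The map `g ↦ g ∗ A` on `L¹(ℂⁿ)`. -/
def convFunL (A : BOp n p t) : L1 n →L[ℂ] BOp n p t :=
  LinearMap.mkContinuous
    { toFun := fun g => convFun g A
      map_add' := fun g g' => (convFun_congr_ae (L1.integrable _) (Lp.coeFn_add g g') A).trans
        (convFun_eq_of_weakConv ((L1.integrable g).add (L1.integrable g'))
          ((weakConv_convFun (L1.integrable g) A).add (weakConv_convFun (L1.integrable g') A)))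
      map_smul' := fun c g => (convFun_congr_ae (L1.integrable _) (Lp.coeFn_smul c g) A).trans
        (convFun_eq_of_weakConv ((L1.integrable g).const_mul c)
          ((weakConv_convFun (L1.integrable g) A).smul c)) }
    ‖A‖ (fun g => by
      rw [mul_comm, L1.norm_eq_integral_norm]
      exact norm_convFun_le (L1.integrable g) A)

/-- Shifting `g ∗ A` amounts to translating `g`; translation is continuous in `L¹` and `g ↦ g ∗ A`
is bounded. -/
theorem convFun_mem_C1 {g : (Fin n → ℂ) → ℂ} (hg : Integrable g) (A : BOp n p t) :
    convFun g A ∈ C1 n p t := by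
  have h : ∀ w, shift w (convFun g A) = convFunL A (transL1 w (hg.toL1 g)) := by
    intro w
    have h1 : Integrable fun z => g (z - w) := hg.comp_sub_right w
    rw [← convFun_eq_of_weakConv h1 ((weakConv_convFun hg A).shift w)]
    refine convFun_congr_ae h1 ?_ A
    filter_upwards [coeFn_transL1 w (hg.toL1 g), ae_comp_sub w hg.coeFn_toL1] with z h2 h3
    rw [h2, h3]
  change Continuous fun w => shift w (convFun g A)
  simp only [h]
  exact (convFunL A).continuous.comp (continuous_transL1 _)

theorem isClosed_C1 : IsClosed (C1 n p t) :=
  isClosed_contVec (isIsometricAction_shiftL (n := n) (p := p) (t := t))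

/-! ### Descriptions of `C₁` by convolutions with functions -/

theorem tendsto_convFun_gauss {A : BOp n p t} (hA : A ∈ C1 n p t) :
    Tendsto (fun s : ℝ => convFun (fun z => ((gauss n s z : ℝ) : ℂ)) A) (𝓝[>] 0) (𝓝 A) := by
  have h := tendsto_integral_gauss_smul (n := n) (F := fun z => shift z A) hA
    (fun z => norm_shift_le z A)
  rw [shift_zero] at h
  refine h.congr' ?_
  filter_upwards [self_mem_nhdsWithin] with s hs
  exact (convFun_eq_integral (integrable_gauss_complex n hs) hA).symm

theorem mem_of_tendsto_convFun_gauss {S : Set (BOp n p t)} (hS : IsClosed S) {A : BOp n p t}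
    (hmem : ∀ s : ℝ, 0 < s → convFun (fun z => ((gauss n s z : ℝ) : ℂ)) A ∈ S)
    (h : Tendsto (fun s : ℝ => convFun (fun z => ((gauss n s z : ℝ) : ℂ)) A) (𝓝[>] 0) (𝓝 A)) :
    A ∈ S :=
  hS.mem_of_tendsto h (by filter_upwards [self_mem_nhdsWithin] with s hs; exact hmem s hs)

theorem C1_eq_gauss : C1 n p t = {B | Tendsto (fun s : ℝ => convFun
      (fun z => ((gauss n s z : ℝ) : ℂ)) B) (𝓝[>] 0) (𝓝 B)} :=
  Set.Subset.antisymm (fun _ hA => tendsto_convFun_gauss hA) fun B hB =>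
    mem_of_tendsto_convFun_gauss isClosed_C1
      (fun _ hs => convFun_mem_C1 (integrable_gauss_complex n hs) B) hB

theorem C1_eq_closure_span : C1 n p t = closure (Submodule.span ℂ
      {A | ∃ (g : (Fin n → ℂ) → ℂ) (B : BOp n p t), Integrable g volume ∧ A = convFun g B} :
        Set (BOp n p t)) := by
  refine Set.Subset.antisymm (fun A hA => ?_) (closure_minimal ?_ isClosed_C1)
  · refine mem_of_tendsto_convFun_gauss isClosed_closure (fun s hs => ?_) (tendsto_convFun_gauss hA)
    exact subset_closure (Submodule.subset_span ⟨_, A, integrable_gauss_complex n hs, rfl⟩)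
  · have : Submodule.span ℂ {A | ∃ (g : (Fin n → ℂ) → ℂ) (B : BOp n p t),
        Integrable g volume ∧ A = convFun g B} ≤ contVec (shiftL (n := n) (p := p) (t := t)) := by
      rw [Submodule.span_le]
      rintro A ⟨g, B, hg, rfl⟩
      exact convFun_mem_C1 hg B
    exact this

/-- The action restricts to the Banach space `C1`, where it is strongly continuous, so Cohen's
factorization applies there. -/
theorem C1_eq_factor : C1 n p t = {A | ∃ (g : (Fin n → ℂ) → ℂ), Integrable g volume ∧
      ∃ B ∈ C1 n p t, A = convFun g B} := by
  refine Set.Subset.antisymm (fun A hA => ?_) ?_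
  · let E := contVec (shiftL (n := n) (p := p) (t := t))
    have hE : ∀ (z : Fin n → ℂ) (B : E), shiftL z (B : BOp n p t) ∈ E := by
      intro z B
      have hB : Continuous fun w => shift w (B : BOp n p t) := B.2
      change Continuous fun w => shift w (shift z (B : BOp n p t))
      simp only [← shift_add]
      exact hB.comp (continuous_id.add continuous_const)
    let β : (Fin n → ℂ) → E →L[ℂ] E := fun z => ((shiftL z).comp E.subtypeL).codRestrict E (hE z)
    have hβ : IsIsometricAction β :=
      { norm_le := fun z B => norm_shift_le z B.1
        zero := fun B => Subtype.ext (shift_zero B.1)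
        add := fun z w B => Subtype.ext (shift_add z w B.1) }
    have hc : ∀ B, Continuous fun z => β z B := fun B =>
      Continuous.subtype_mk (show Continuous fun z => shift z B.1 from B.2) _
    have hcl : IsClosed (E : Set (BOp n p t)) := isClosed_C1
    have : CompleteSpace E := hcl.completeSpace_coe
    obtain ⟨g, B, hgB⟩ := exists_convL_eq hβ hc ⟨A, hA⟩
    refine ⟨g, L1.integrable g, B.1, B.2, ?_⟩
    rw [convFun_eq_integral (L1.integrable g) B.2]
    have h1 := congrArg E.subtypeL hgB
    rw [convL_apply, ← E.subtypeL.integral_comp_comm (integrable_smul_of_bounded (L1.integrable g)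
      (hc B) (fun z => hβ.norm_le z B))] at h1
    exact h1.symm
  · rintro A ⟨g, hg, B, -, rfl⟩
    exact convFun_mem_C1 hg B

/-! ### Kernel vectors and weighted functions -/

/-- The normalized reproducing kernel `k_z = W_z 1` as an element of `F_t^p`. -/
def kvec (z : Fin n → ℂ) : FockSpace n p t := weyl z fockOne

theorem kvec_apply (z w : Fin n → ℂ) : (kvec z : FockSpace n p t) w = nkernel t z w := by
  rw [kvec, weyl_apply]
  exact mul_one _

theorem continuous_kvec : Continuous (kvec : (Fin n → ℂ) → FockSpace n p t) :=
  continuous_weyl fockOne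

theorem norm_kvec (z : Fin n → ℂ) : ‖(kvec z : FockSpace n p t)‖ = ‖(fockOne : FockSpace n p t)‖ :=
  norm_weyl z _

/-- The weight `e^{-|z|² / (2t)}`. -/
def weight (t : ℝ) (z : Fin n → ℂ) : ℝ := Real.exp (-(sqNorm z / (2 * t)))

theorem weight_pos (z : Fin n → ℂ) : 0 < weight t z := Real.exp_pos _

theorem continuous_weight : Continuous (weight (n := n) t) := by
  have := continuous_sqNorm (n := n)
  unfold weight
  fun_prop

/-- `W_{-z}` turns evaluation at `0` into weighted evaluation at `z`, and `W_z` sends the constant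
`1` to `k_z`. -/
theorem shift_Rop_apply (z : Fin n → ℂ) (x : FockSpace n p t) :
    shift z Rop x = (((1 / (Real.pi * t) ^ n : ℝ) : ℂ) * ((weight t z : ℝ) * x z)) • kvec z := by
  have h : (Rop : BOp n p t) (weyl (-z) x) =
      (((1 / (Real.pi * t) ^ n : ℝ) : ℂ) * ((weyl (-z) x) 0)) • fockOne := by
    rw [mul_smul]; rfl
  rw [shift_apply, h, map_smul, kvec, weyl_apply, zero_sub, neg_neg, nkernel, hdot_zero_left,
    sqNorm_neg, weight, Complex.ofReal_exp]
  simp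

theorem continuous_weighted (x : FockSpace n p t) :
    Continuous fun z => ((weight t z : ℝ) : ℂ) * x z :=
  (Complex.continuous_ofReal.comp continuous_weight).mul x.2.1.continuous

theorem enorm_ofReal_complex {r : ℝ} (hr : 0 ≤ r) : ‖(r : ℂ)‖ₑ = ENNReal.ofReal r := by
  rw [← ofReal_norm, Complex.norm_real, Real.norm_of_nonneg hr]

/-- The normalization constant of `μ_{2t/p}`. -/
def fockConst (n : ℕ) (p t : ℝ) : ℝ≥0∞ := ENNReal.ofReal (1 / (Real.pi * (2 * t / p)) ^ n)

theorem fockConst_ne_zero : fockConst n p t ≠ 0 := by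
  have := scale_pos hp.out ht.out
  rw [fockConst, ne_eq, ENNReal.ofReal_eq_zero, not_le]
  positivity

theorem fockConst_ne_top : fockConst n p t ≠ ∞ := ENNReal.ofReal_ne_top

theorem gauss_mul_enorm_rpow (h : (Fin n → ℂ) → ℂ) (w : Fin n → ℂ) :
    ENNReal.ofReal (gauss n (2 * t / p) w) * ‖h w‖ₑ ^ p =
      fockConst n p t * ‖((weight t w : ℝ) : ℂ) * h w‖ₑ ^ p := by
  have hp0 : 0 < p := by linarith [hp.out]
  have ht0 := ht.out
  have hs := scale_pos hp.out ht.out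
  have e : gauss n (2 * t / p) w = 1 / (Real.pi * (2 * t / p)) ^ n * (weight t w) ^ p := by
    rw [gauss, weight, ← Real.exp_mul]
    congr 2
    field_simp
  rw [e, ENNReal.ofReal_mul (by positivity), enorm_mul, ENNReal.mul_rpow_of_nonneg _ _ hp0.le,
    enorm_ofReal_complex (weight_pos w).le, ENNReal.ofReal_rpow_of_nonneg (weight_pos w).le hp0.le,
    mul_assoc, fockConst]

/-- The norm of `F_t^p` is a multiple of the unweighted `L^p` norm of `e^{-|w|²/(2t)} f(w)`; the
scale `2t/p` is chosen so that this weight does not depend on `p`. -/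
theorem enorm_rpow_eq (f : FockSpace n p t) :
    ‖f‖ₑ ^ p = fockConst n p t * ∫⁻ w, ‖((weight t w : ℝ) : ℂ) * f w‖ₑ ^ p := by
  have hp0 : 0 < p := by linarith [hp.out]
  have h : ‖f‖ₑ = eLpNorm f.1 (ENNReal.ofReal p) (gaussMeasure n (2 * t / p)) := by
    rw [← ofReal_norm, norm_def, ENNReal.ofReal_toReal f.2.2.2.ne]
  rw [h, eLpNorm_fock, ← ENNReal.rpow_mul, one_div_mul_cancel hp0.ne', ENNReal.rpow_one,
    ← lintegral_const_mul' _ _ fockConst_ne_top]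
  exact lintegral_congr fun w => gauss_mul_enorm_rpow f.1 w

/-! ### Boundedness of the kernel transform -/

theorem weight_mul_norm_nkernel (z w : Fin n → ℂ) :
    weight t w * ‖nkernel t z w‖ = weight t (w - z) := by
  have ht0 := ht.out
  rw [norm_nkernel, weight, weight, ← Real.exp_add, sqNorm_sub]
  congr 1
  field_simp
  ring

theorem lintegral_rpow_le_of_isProbabilityMeasure {X : Type*} [MeasurableSpace X] {μ : Measure X}
    [IsProbabilityMeasure μ] {q : ℝ} (hq : 1 ≤ q) {φ : X → ℂ} (hφ : AEStronglyMeasurable φ μ) :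
    (∫⁻ x, ‖φ x‖ₑ ∂μ) ^ q ≤ ∫⁻ x, ‖φ x‖ₑ ^ q ∂μ := by
  have hq0 : 0 < q := by linarith
  have h := eLpNorm_le_eLpNorm_of_exponent_le (p := 1) (q := ENNReal.ofReal q)
    (by rw [← ENNReal.ofReal_one]; exact ENNReal.ofReal_le_ofReal hq) hφ
  rw [eLpNorm_one_eq_lintegral_enorm, eLpNorm_eq_lintegral_rpow_enorm_toReal (by simpa using hq0)
    ENNReal.ofReal_ne_top, ENNReal.toReal_ofReal hq0.le] at h
  have h' := ENNReal.rpow_le_rpow h hq0.le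
  rwa [← ENNReal.rpow_mul, one_div_mul_cancel hq0.ne', ENNReal.rpow_one] at h'

/-- Young's inequality for a probability measure: Jensen inside, then Tonelli and translation
invariance. -/
theorem lintegral_conv_gauss_rpow_le {s : ℝ} (hs : 0 < s) {q : ℝ} (hq : 1 ≤ q)
    {φ : (Fin n → ℂ) → ℂ} (hφ : Measurable φ) :
    ∫⁻ w, (∫⁻ u, ‖φ (w - u)‖ₑ ∂gaussMeasure n s) ^ q ≤ ∫⁻ w, ‖φ w‖ₑ ^ q := by
  have := isProbabilityMeasure_gauss n hs
  calc ∫⁻ w, (∫⁻ u, ‖φ (w - u)‖ₑ ∂gaussMeasure n s) ^ q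
      ≤ ∫⁻ w, ∫⁻ u, ‖φ (w - u)‖ₑ ^ q ∂gaussMeasure n s := by
        refine lintegral_mono fun w => lintegral_rpow_le_of_isProbabilityMeasure hq ?_
        exact (hφ.comp (measurable_const.sub measurable_id)).aestronglyMeasurable
    _ = ∫⁻ u, ∫⁻ w, ‖φ (w - u)‖ₑ ^ q ∂volume ∂gaussMeasure n s := by
        refine lintegral_lintegral_swap (Measurable.aemeasurable ?_)
        exact ((hφ.comp (measurable_fst.sub measurable_snd)).enorm).pow_const q
    _ = ∫⁻ w, ‖φ w‖ₑ ^ q := by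
        simp only [lintegral_sub_right_eq_self (fun w => ‖φ w‖ₑ ^ q)]
        simp

/-- The constant in the estimate of the kernel transform. -/
def kernelConst (n : ℕ) (p t : ℝ) : ℝ≥0∞ :=
  fockConst n p t * ENNReal.ofReal ((Real.pi * (2 * t)) ^ n) ^ p

theorem kernelConst_ne_top : kernelConst n p t ≠ ∞ :=
  ENNReal.mul_ne_top fockConst_ne_top
    (ENNReal.rpow_ne_top_of_nonneg (by linarith [hp.out]) ENNReal.ofReal_ne_top)

theorem integrable_smul_kvec {φ : (Fin n → ℂ) → ℂ} (hφ : Integrable φ) :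
    Integrable fun z => φ z • (kvec z : FockSpace n p t) :=
  integrable_smul_of_bounded hφ continuous_kvec fun z => (norm_kvec z).le

/-- Since `e^{-|w|²/(2t)} |k_z(w)| = e^{-|w-z|²/(2t)}`, the weighted integral is dominated by the
convolution of `|φ|` with `(2πt)ⁿ f_{2t}`. -/
theorem enorm_integral_smul_kvec_le {φ : (Fin n → ℂ) → ℂ} (hm : Measurable φ)
    (hφ : Integrable φ) :
    ‖∫ z, φ z • (kvec z : FockSpace n p t)‖ₑ ^ p ≤ kernelConst n p t * ∫⁻ z, ‖φ z‖ₑ ^ p := by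
  have hp0 : 0 < p := by linarith [hp.out]
  have ht0 := ht.out
  set c : ℝ≥0∞ := ENNReal.ofReal ((Real.pi * (2 * t)) ^ n) with hc
  have hpt : ∀ w, ‖((weight t w : ℝ) : ℂ) * (∫ z, φ z • (kvec z : FockSpace n p t)) w‖ₑ ≤
      c * ∫⁻ u, ‖φ (w - u)‖ₑ ∂gaussMeasure n (2 * t) := by
    intro w
    have h1 : (∫ z, φ z • (kvec z : FockSpace n p t)) w = ∫ z, φ z * nkernel t z w := by
      have h2 := (evalCLM (p := p) (t := t) w).integral_comp_comm
        (integrable_smul_kvec (p := p) (t := t) hφ)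
      simp only [map_smul, evalCLM_apply, kvec_apply, smul_eq_mul] at h2
      exact h2.symm
    rw [h1, ← integral_const_mul]
    refine (enorm_integral_le_lintegral_enorm _).trans (le_of_eq ?_)
    rw [lintegral_gauss, ← lintegral_const_mul' _ _ ENNReal.ofReal_ne_top,
      ← lintegral_sub_left_eq_self (fun u => c * (ENNReal.ofReal (gauss n (2 * t) u) *
        ‖φ (w - u)‖ₑ)) w]
    refine lintegral_congr fun z => ?_
    rw [sub_sub_cancel, hc, ← mul_assoc (ENNReal.ofReal _) (ENNReal.ofReal _),
      ← ENNReal.ofReal_mul (by positivity)]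
    have h3 : (Real.pi * (2 * t)) ^ n * gauss n (2 * t) (w - z) =
        weight t w * ‖nkernel t z w‖ := by
      rw [weight_mul_norm_nkernel, gauss, weight, neg_div]
      field_simp
    rw [h3, ENNReal.ofReal_mul (weight_pos w).le, ofReal_norm, enorm_mul, enorm_mul,
      enorm_ofReal_complex (weight_pos w).le]
    ring
  rw [enorm_rpow_eq, kernelConst, mul_assoc]
  gcongr
  calc ∫⁻ w, ‖((weight t w : ℝ) : ℂ) * (∫ z, φ z • (kvec z : FockSpace n p t)) w‖ₑ ^ p
      ≤ ∫⁻ w, c ^ p * (∫⁻ u, ‖φ (w - u)‖ₑ ∂gaussMeasure n (2 * t)) ^ p := by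
        refine lintegral_mono fun w => ?_
        simp only
        rw [← ENNReal.mul_rpow_of_nonneg _ _ hp0.le]
        exact ENNReal.rpow_le_rpow (hpt w) hp0.le
    _ ≤ c ^ p * ∫⁻ z, ‖φ z‖ₑ ^ p := by
        rw [lintegral_const_mul' _ _ (ENNReal.rpow_ne_top_of_nonneg hp0.le ENNReal.ofReal_ne_top)]
        refine mul_le_mul' le_rfl ?_
        exact lintegral_conv_gauss_rpow_le (by positivity) hp.out.le hm

/-! ### The dual estimate -/

theorem enorm_integral_smul_kvec_le' {φ : (Fin n → ℂ) → ℂ} (hm : Measurable φ)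
    (hφ : Integrable φ) : ‖∫ z, φ z • (kvec z : FockSpace n p t)‖ₑ ≤
      (kernelConst n p t * ∫⁻ z, ‖φ z‖ₑ ^ p) ^ (1 / p) := by
  have hp0 : 0 < p := by linarith [hp.out]
  have h := ENNReal.rpow_le_rpow (enorm_integral_smul_kvec_le (p := p) (t := t) hm hφ)
    (z := 1 / p) (by positivity)
  rwa [← ENNReal.rpow_mul, mul_one_div_cancel hp0.ne', ENNReal.rpow_one] at h

theorem exists_measurable_phase {ψ : (Fin n → ℂ) → ℂ} (hψ : Measurable ψ) :
    ∃ θ : (Fin n → ℂ) → ℂ, Measurable θ ∧ (∀ z, ‖θ z‖ ≤ 1) ∧ ∀ z, θ z * ψ z = ((‖ψ z‖ : ℝ) : ℂ) := by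
  refine ⟨fun z => (starRingEnd ℂ) (ψ z) / ((‖ψ z‖ : ℝ) : ℂ), ?_, fun z => ?_, fun z => ?_⟩
  · exact (Complex.continuous_conj.measurable.comp hψ).div
      (Complex.measurable_ofReal.comp hψ.norm)
  · rw [norm_div, Complex.norm_real, norm_norm, RCLike.norm_conj]
    exact div_self_le_one _
  · by_cases h : ψ z = 0
    · simp [h]
    · have h' : ((‖ψ z‖ : ℝ) : ℂ) ≠ 0 := by simpa using h
      rw [div_mul_eq_mul_div, div_eq_iff h', mul_comm, Complex.mul_conj, Complex.normSq_eq_norm_sq]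
      push_cast
      ring

/-- Multiplying `φ` by a unimodular or zero phase makes `φ(z) y(k_z)` nonnegative, so its integral
is `y` applied to a kernel transform, which `enorm_integral_smul_kvec_le'` bounds. No description of
the dual space is needed. -/
theorem lintegral_enorm_mul_dual_kvec_le {φ : (Fin n → ℂ) → ℂ} (hm : Measurable φ)
    (y : FockSpace n p t →L[ℂ] ℂ) :
    ∫⁻ z, ‖φ z * y (kvec z)‖ₑ ≤ ‖y‖ₑ * (kernelConst n p t * ∫⁻ z, ‖φ z‖ₑ ^ p) ^ (1 / p) := by
  have hp0 : 0 < p := by linarith [hp.out]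
  have hyc : Continuous fun z : Fin n → ℂ => y (kvec z) := y.continuous.comp continuous_kvec
  obtain ⟨θ, hθm, hθ1, hθ⟩ := exists_measurable_phase
    (ψ := fun z => φ z * y (kvec z)) (hm.mul hyc.measurable)
  -- On these sets of finite measure `φ` is bounded, so the vector integral exists; monotone
  -- exhaustion removes the truncation.
  let S : ℕ → Set (Fin n → ℂ) := fun m => {z | ‖z‖ ≤ m} ∩ {z | ‖φ z‖ ≤ m}
  have hSm : ∀ m, MeasurableSet (S m) := fun m =>
    (measurableSet_le measurable_norm measurable_const).inter
      (measurableSet_le hm.norm measurable_const)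
  have hSmono : Monotone S := fun a b hab z hz =>
    ⟨show ‖z‖ ≤ b from le_trans hz.1 (Nat.cast_le.2 hab),
      show ‖φ z‖ ≤ b from le_trans hz.2 (Nat.cast_le.2 hab)⟩
  have hSU : ⋃ m, S m = Set.univ := by
    refine Set.eq_univ_of_forall fun z => Set.mem_iUnion.2 ?_
    obtain ⟨m, hm⟩ := exists_nat_ge (max ‖z‖ ‖φ z‖)
    exact ⟨m, (le_max_left _ _).trans hm, (le_max_right _ _).trans hm⟩
  rw [← setLIntegral_univ, ← hSU, setLIntegral_iUnion_of_directed _ hSmono.directed_le]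
  refine iSup_le fun m => ?_
  let φm : (Fin n → ℂ) → ℂ := (S m).indicator fun z => θ z * φ z
  have hφm : Measurable φm := (hθm.mul hm).indicator (hSm m)
  have hSfin : volume (S m) < ∞ := by
    refine lt_of_le_of_lt (measure_mono (t := Metric.closedBall 0 m) ?_)
      (isCompact_closedBall _ _).measure_lt_top
    intro z hz
    simpa using hz.1
  have hle : ∀ z, ‖φm z‖ ≤ ‖φ z‖ := by
    intro z
    refine (norm_indicator_le_norm_self _ z).trans ?_
    rw [norm_mul]
    exact mul_le_of_le_one_left (norm_nonneg _) (hθ1 z)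
  have hint : Integrable φm := by
    rw [integrable_indicator_iff (hSm m)]
    refine IntegrableOn.of_bound hSfin (hθm.mul hm).aestronglyMeasurable m ?_
    filter_upwards [ae_restrict_mem (hSm m)] with z hz
    rw [norm_mul]
    exact (mul_le_of_le_one_left (norm_nonneg _) (hθ1 z)).trans hz.2
  have hy := y.integral_comp_comm (integrable_smul_kvec (p := p) (t := t) hint)
  have hyi := y.integrable_comp (integrable_smul_kvec (p := p) (t := t) hint)
  have e1 : ∀ z, y (φm z • kvec z) =
      (((S m).indicator (fun z => ‖φ z * y (kvec z)‖) z : ℝ) : ℂ) := by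
    intro z
    rw [map_smul, smul_eq_mul]
    by_cases hz : z ∈ S m
    · rw [Set.indicator_of_mem hz, ← hθ z]
      simp only [φm, Set.indicator_of_mem hz]
      ring
    · simp [φm, Set.indicator_of_notMem hz]
  have hfin : ∫⁻ z in S m, ‖φ z * y (kvec z)‖ₑ = ‖y (∫ z, φm z • kvec z)‖ₑ := by
    rw [← hy]
    simp only [e1] at hyi ⊢
    have hnn : 0 ≤ fun z => (S m).indicator (fun z => ‖φ z * y (kvec z)‖) z := fun z =>
      Set.indicator_nonneg (fun _ _ => norm_nonneg _) z
    rw [integral_complex_ofReal, enorm_ofReal_complex (integral_nonneg hnn),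
      ofReal_integral_eq_lintegral_ofReal (by simpa using hyi.re) (Eventually.of_forall hnn),
      ← lintegral_indicator (hSm m)]
    refine lintegral_congr fun z => ?_
    by_cases hz : z ∈ S m
    · simp [hz, Set.indicator_of_mem]
    · simp [hz, Set.indicator_of_notMem]
  rw [hfin]
  refine (y.le_opENorm _).trans ?_
  gcongr
  refine (enorm_integral_smul_kvec_le' hφm hint).trans ?_
  gcongr with z
  exact enorm_le_iff_norm_le.2 (hle z)

/-! ### Toeplitz operators with bounded symbols -/

/-- The function `φ` with `α_z(R_t) x = φ(z) k_z`. -/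
def ropCoeff (x : FockSpace n p t) (z : Fin n → ℂ) : ℂ :=
  ((1 / (Real.pi * t) ^ n : ℝ) : ℂ) * ((weight t z : ℝ) * x z)

theorem continuous_ropCoeff (x : FockSpace n p t) : Continuous (ropCoeff x) :=
  continuous_const.mul (continuous_weighted x)

theorem dual_shift_Rop (y : FockSpace n p t →L[ℂ] ℂ) (z : Fin n → ℂ) (x : FockSpace n p t) :
    y (shift z Rop x) = ropCoeff x z * y (kvec z) := by
  rw [shift_Rop_apply, map_smul, smul_eq_mul, ropCoeff]

theorem lintegral_ropCoeff (x : FockSpace n p t) :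
    ∫⁻ z, ‖ropCoeff x z‖ₑ ^ p =
      ‖((1 / (Real.pi * t) ^ n : ℝ) : ℂ)‖ₑ ^ p * ((fockConst n p t)⁻¹ * ‖x‖ₑ ^ p) := by
  have hp0 : 0 < p := by linarith [hp.out]
  have h : ∀ z, ‖ropCoeff x z‖ₑ ^ p = ‖((1 / (Real.pi * t) ^ n : ℝ) : ℂ)‖ₑ ^ p *
      ‖((weight t z : ℝ) : ℂ) * x z‖ₑ ^ p := fun z => by
    rw [ropCoeff, enorm_mul, ENNReal.mul_rpow_of_nonneg _ _ hp0.le]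
  simp only [h]
  rw [lintegral_const_mul' _ _ (ENNReal.rpow_ne_top_of_nonneg hp0.le enorm_ne_top), enorm_rpow_eq,
    ← mul_assoc (fockConst n p t)⁻¹, ENNReal.inv_mul_cancel fockConst_ne_zero fockConst_ne_top,
    one_mul]

theorem lintegral_ropCoeff_ne_top (x : FockSpace n p t) : ∫⁻ z, ‖ropCoeff x z‖ₑ ^ p ≠ ∞ := by
  have hp0 : 0 < p := by linarith [hp.out]
  rw [lintegral_ropCoeff]
  exact ENNReal.mul_ne_top (ENNReal.rpow_ne_top_of_nonneg hp0.le enorm_ne_top)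
    (ENNReal.mul_ne_top (ENNReal.inv_ne_top.2 fockConst_ne_zero)
      (ENNReal.rpow_ne_top_of_nonneg hp0.le enorm_ne_top))

theorem integrable_dual_shift_Rop (y : FockSpace n p t →L[ℂ] ℂ) (x : FockSpace n p t) :
    Integrable fun z => y (shift z Rop x) := by
  have hp0 : 0 < p := by linarith [hp.out]
  refine ⟨(y.continuous.comp (continuous_shift_apply Rop x)).aestronglyMeasurable, ?_⟩
  simp only [HasFiniteIntegral, dual_shift_Rop]
  refine (lintegral_enorm_mul_dual_kvec_le (continuous_ropCoeff x).measurable y).trans_lt ?_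
  exact ENNReal.mul_lt_top enorm_lt_top (ENNReal.rpow_lt_top_of_nonneg (by positivity)
    (ENNReal.mul_ne_top kernelConst_ne_top (lintegral_ropCoeff_ne_top x)))

theorem integral_norm_le_of_lintegral {X : Type*} [MeasurableSpace X] {μ : Measure X} {F : X → ℂ}
    (hF : Integrable F μ) {C : ℝ≥0∞} (hC : C ≠ ∞) (h : ∫⁻ z, ‖F z‖ₑ ∂μ ≤ C) :
    ∫ z, ‖F z‖ ∂μ ≤ C.toReal := by
  rw [integral_norm_eq_lintegral_enorm hF.1]
  exact ENNReal.toReal_mono hC h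

theorem exists_integral_norm_dual_shift_Rop_le (n : ℕ) (p t : ℝ) [hp : Fact (1 < p)]
    [ht : Fact (0 < t)] : ∃ K : ℝ, 0 ≤ K ∧
    ∀ (y : FockSpace n p t →L[ℂ] ℂ) (x : FockSpace n p t),
      ∫ z, ‖y (shift z Rop x)‖ ≤ K * (‖y‖ * ‖x‖) := by
  have hp0 : 0 < p := by linarith [hp.out]
  set D : ℝ≥0∞ := kernelConst n p t * (‖((1 / (Real.pi * t) ^ n : ℝ) : ℂ)‖ₑ ^ p *
    (fockConst n p t)⁻¹) with hD
  have hD' : D ^ (1 / p) ≠ ∞ := ENNReal.rpow_ne_top_of_nonneg (by positivity)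
    (ENNReal.mul_ne_top kernelConst_ne_top (ENNReal.mul_ne_top
      (ENNReal.rpow_ne_top_of_nonneg hp0.le enorm_ne_top) (ENNReal.inv_ne_top.2 fockConst_ne_zero)))
  refine ⟨(D ^ (1 / p)).toReal, ENNReal.toReal_nonneg, fun y x => ?_⟩
  have h := lintegral_enorm_mul_dual_kvec_le (continuous_ropCoeff x).measurable y
  have e : kernelConst n p t * ∫⁻ z, ‖ropCoeff x z‖ₑ ^ p = D * ‖x‖ₑ ^ p := by
    rw [lintegral_ropCoeff, hD]; ring
  rw [e, ENNReal.mul_rpow_of_nonneg _ _ (by positivity), ← ENNReal.rpow_mul,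
    mul_one_div_cancel hp0.ne', ENNReal.rpow_one] at h
  simp only [← dual_shift_Rop] at h
  have h' := integral_norm_le_of_lintegral (integrable_dual_shift_Rop y x)
    (ENNReal.mul_ne_top enorm_ne_top (ENNReal.mul_ne_top hD' enorm_ne_top)) h
  rw [ENNReal.toReal_mul, ENNReal.toReal_mul, toReal_enorm, toReal_enorm] at h'
  refine h'.trans (le_of_eq ?_)
  ring

/-- The complement of the ball of radius `N`. -/
def farSet (n N : ℕ) : Set (Fin n → ℂ) := {z | (N : ℝ) < ‖z‖}

theorem measurableSet_farSet (N : ℕ) : MeasurableSet (farSet n N) :=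
  measurableSet_lt measurable_const measurable_norm

/-- The dual estimate for `φ` cut off to `|z| > N`, whose `L^p` norm tends to `0`. The bound is
uniform in `y` on bounded sets, which later yields norm convergence of truncated integrals on each
vector `x`. -/
theorem exists_tail_bound (x : FockSpace n p t) : ∃ b : ℕ → ℝ, Tendsto b atTop (𝓝 0) ∧
    ∀ (y : FockSpace n p t →L[ℂ] ℂ) N,
      ∫ z in farSet n N, ‖y (shift z Rop x)‖ ≤ ‖y‖ * b N := by
  have hp0 : 0 < p := by linarith [hp.out]
  let φ : ℕ → (Fin n → ℂ) → ℂ := fun N => (farSet n N).indicator (ropCoeff x)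
  have hφm : ∀ N, Measurable (φ N) := fun N =>
    (continuous_ropCoeff x).measurable.indicator (measurableSet_farSet N)
  have hle : ∀ N, ∫⁻ z, ‖φ N z‖ₑ ^ p ≤ ∫⁻ z, ‖ropCoeff x z‖ₑ ^ p := fun N =>
    lintegral_mono fun z => ENNReal.rpow_le_rpow
      (enorm_le_iff_norm_le.2 (norm_indicator_le_norm_self _ z)) hp0.le
  have hlim : Tendsto (fun N => ∫⁻ z, ‖φ N z‖ₑ ^ p) atTop (𝓝 0) := by
    have h := tendsto_lintegral_of_dominated_convergence (μ := (volume : Measure (Fin n → ℂ)))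
      (F := fun N z => ‖φ N z‖ₑ ^ p) (f := fun _ => 0) (fun z => ‖ropCoeff x z‖ₑ ^ p)
      (fun N => (hφm N).enorm.pow_const p)
      (fun N => Eventually.of_forall fun z => ENNReal.rpow_le_rpow
        (enorm_le_iff_norm_le.2 (norm_indicator_le_norm_self _ z)) hp0.le)
      (lintegral_ropCoeff_ne_top x) (Eventually.of_forall fun z => by
        refine tendsto_const_nhds.congr' ?_
        obtain ⟨N, hN⟩ := exists_nat_ge ‖z‖
        filter_upwards [eventually_ge_atTop N] with M hM
        have : z ∉ farSet n M := not_lt.2 (hN.trans (by exact_mod_cast hM))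
        simp [φ, Set.indicator_of_notMem this, ENNReal.zero_rpow_of_pos hp0])
    simpa using h
  have hlim2 : Tendsto (fun N => ((kernelConst n p t * ∫⁻ z, ‖φ N z‖ₑ ^ p) ^ (1 / p)).toReal)
      atTop (𝓝 0) := by
    have h1 := ENNReal.Tendsto.const_mul hlim (Or.inr (kernelConst_ne_top (n := n) (p := p) (t := t)))
    have h2 := ((ENNReal.continuous_rpow_const (y := 1 / p)).tendsto _).comp h1
    rw [mul_zero, ENNReal.zero_rpow_of_pos (by positivity)] at h2
    exact (ENNReal.tendsto_toReal ENNReal.zero_ne_top).comp h2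
  refine ⟨_, hlim2, fun y N => ?_⟩
  have h := lintegral_enorm_mul_dual_kvec_le (hφm N) y
  have e : ∫⁻ z, ‖φ N z * y (kvec z)‖ₑ = ∫⁻ z in farSet n N, ‖y (shift z Rop x)‖ₑ := by
    rw [← lintegral_indicator (measurableSet_farSet N)]
    refine lintegral_congr fun z => ?_
    by_cases hz : z ∈ farSet n N
    · simp only [φ, Set.indicator_of_mem hz, dual_shift_Rop]
    · simp [φ, Set.indicator_of_notMem hz]
  rw [e] at h
  have h' := integral_norm_le_of_lintegral (integrable_dual_shift_Rop y x).integrableOn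
    (ENNReal.mul_ne_top enorm_ne_top (ENNReal.rpow_ne_top_of_nonneg (by positivity)
      (ENNReal.mul_ne_top kernelConst_ne_top
        (ne_top_of_le_ne_top (lintegral_ropCoeff_ne_top x) (hle N))))) h
  rwa [ENNReal.toReal_mul, toReal_enorm] at h'

theorem integrable_indicator_ball {f : (Fin n → ℂ) → ℂ} (hf : Measurable f) {M : ℝ}
    (hM : ∀ z, ‖f z‖ ≤ M) (N : ℕ) : Integrable ((farSet n N)ᶜ.indicator f) := by
  rw [integrable_indicator_iff (measurableSet_farSet N).compl]
  refine IntegrableOn.of_bound ?_ hf.aestronglyMeasurable M (Eventually.of_forall hM)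
  refine lt_of_le_of_lt (measure_mono (t := Metric.closedBall 0 N) ?_)
    (isCompact_closedBall _ _).measure_lt_top
  intro z hz
  have : ¬ ((N : ℝ) < ‖z‖) := hz
  simpa using this

theorem norm_indicator_sub_le {X : Type*} {f : X → ℂ} {M : ℝ} (hM : ∀ z, ‖f z‖ ≤ M)
    {S T U : Set X} (hS : Sᶜ ⊆ U) (hT : Tᶜ ⊆ U) (z : X) :
    ‖S.indicator f z - T.indicator f z‖ ≤ U.indicator (fun _ => M) z := by
  have hM0 : 0 ≤ M := (norm_nonneg _).trans (hM z)
  by_cases hu : z ∈ U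
  · rw [Set.indicator_of_mem hu]
    by_cases hs : z ∈ S <;> by_cases htt : z ∈ T <;> simp [hs, htt, hM0, hM z]
  · have hs : z ∈ S := by by_contra h; exact hu (hS h)
    have htt : z ∈ T := by by_contra h; exact hu (hT h)
    simp [hs, htt, hu]

theorem norm_integral_indicator_sub_le {f : (Fin n → ℂ) → ℂ} {M : ℝ}
    (hM : ∀ z, ‖f z‖ ≤ M) {S T : Set (Fin n → ℂ)} {N : ℕ} (hS : Sᶜ ⊆ farSet n N)
    (hT : Tᶜ ⊆ farSet n N) (y : FockSpace n p t →L[ℂ] ℂ) (x : FockSpace n p t) :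
    ‖∫ z, (S.indicator f z - T.indicator f z) * y (shift z Rop x)‖ ≤
      M * ∫ z in farSet n N, ‖y (shift z Rop x)‖ := by
  rw [← integral_indicator (measurableSet_farSet N), ← integral_const_mul]
  refine norm_integral_le_of_norm_le
    (((integrable_dual_shift_Rop y x).norm.indicator (measurableSet_farSet N)).const_mul M)
    (Eventually.of_forall fun z => ?_)
  rw [norm_mul]
  refine (mul_le_mul_of_nonneg_right (norm_indicator_sub_le hM hS hT z) (norm_nonneg _)).trans
    (le_of_eq ?_)
  by_cases hz : z ∈ farSet n N <;> simp [hz]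

/-- Restricting `f` to balls gives `L¹` functions and thus operators `C k`. By the tail bound they
are Cauchy on each vector, and Banach–Steinhaus makes the strong limit bounded. -/
theorem exists_weakConv_Rop {f : (Fin n → ℂ) → ℂ} (hf : Measurable f) {M : ℝ}
    (hM : ∀ z, ‖f z‖ ≤ M) : ∃ C : BOp n p t, WeakConv f Rop C := by
  have hM0 : 0 ≤ M := (norm_nonneg _).trans (hM 0)
  have hint := integrable_indicator_ball hf hM
  let C : ℕ → BOp n p t := fun k => strongConv _ (hint k) Rop
  have hC : ∀ k, WeakConv ((farSet n k)ᶜ.indicator f) Rop (C k) := fun k =>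
    weakConv_strongConv (hint k) Rop
  have hsub : ∀ {N k : ℕ}, N ≤ k → ((farSet n k)ᶜ)ᶜ ⊆ farSet n N := by
    intro N k hNk z hz
    rw [compl_compl] at hz
    exact lt_of_le_of_lt (Nat.cast_le.2 hNk) (show (k : ℝ) < ‖z‖ from hz)
  have hlim : ∀ x, ∃ v, Tendsto (fun k => C k x) atTop (𝓝 v) := by
    intro x
    obtain ⟨b, hb, hbound⟩ := exists_tail_bound x
    refine cauchySeq_tendsto_of_complete (cauchySeq_of_le_tendsto_0 (fun N => M * |b N|) ?_ ?_)
    · intro k m N hk hm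
      rw [dist_eq_norm]
      refine NormedSpace.norm_le_dual_bound ℂ _ (by positivity) fun y => ?_
      rw [map_sub, (hC k y x).2, (hC m y x).2, ← integral_sub (hC k y x).1 (hC m y x).1]
      simp only [← sub_mul]
      refine (norm_integral_indicator_sub_le hM (hsub hk) (hsub hm) y x).trans ?_
      have h1 := (hbound y N).trans (mul_le_mul_of_nonneg_left (le_abs_self (b N)) (norm_nonneg y))
      calc _ ≤ M * (‖y‖ * |b N|) := mul_le_mul_of_nonneg_left h1 hM0
        _ = _ := by ring
    · simpa using (hb.abs).const_mul M
  choose v hv using hlim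
  refine ⟨continuousLinearMapOfTendsto C (tendsto_pi_nhds.2 hv), fun y x => ?_⟩
  have hi : Integrable fun z => f z * y (shift z Rop x) :=
    (integrable_dual_shift_Rop y x).bdd_mul hf.aestronglyMeasurable (Eventually.of_forall hM)
  refine ⟨hi, ?_⟩
  change y (v x) = _
  have h1 : Tendsto (fun k => y (C k x)) atTop (𝓝 (y (v x))) :=
    (y.continuous.tendsto _).comp (hv x)
  refine tendsto_nhds_unique h1 ?_
  obtain ⟨b, hb, hbound⟩ := exists_tail_bound x
  rw [tendsto_iff_norm_sub_tendsto_zero]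
  refine squeeze_zero (fun _ => norm_nonneg _) (fun k => ?_)
    (by simpa using (hb.const_mul ‖y‖).const_mul M)
  rw [(hC k y x).2, ← integral_sub (hC k y x).1 hi]
  simp only [← sub_mul]
  -- With `T = univ` the same tail estimate compares the truncation with `f` itself.
  have h2 := norm_integral_indicator_sub_le hM (hsub (le_refl k))
    (T := Set.univ) (by simp) y x
  simp only [Set.indicator_univ] at h2
  exact h2.trans (mul_le_mul_of_nonneg_left (hbound y k) hM0)

theorem norm_mul_dual_shift_Rop_le {f : (Fin n → ℂ) → ℂ} {M : ℝ}
    (hM : ∀ z, ‖f z‖ ≤ M) {K : ℝ} (hK : ∀ (y : FockSpace n p t →L[ℂ] ℂ) (x : FockSpace n p t),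
      ∫ z, ‖y (shift z Rop x)‖ ≤ K * (‖y‖ * ‖x‖)) (y : FockSpace n p t →L[ℂ] ℂ)
    (x : FockSpace n p t) :
    ∫ z, ‖f z * y (shift z Rop x)‖ ≤ (M * K) * (‖y‖ * ‖x‖) := by
  have hM0 : 0 ≤ M := (norm_nonneg _).trans (hM 0)
  calc ∫ z, ‖f z * y (shift z Rop x)‖ ≤ ∫ z, M * ‖y (shift z Rop x)‖ := by
        refine integral_mono_of_nonneg (Eventually.of_forall fun z => norm_nonneg _)
          ((integrable_dual_shift_Rop y x).norm.const_mul M) (Eventually.of_forall fun z => ?_)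
        simp only [norm_mul]
        exact mul_le_mul_of_nonneg_right (hM z) (norm_nonneg _)
    _ ≤ M * (K * (‖y‖ * ‖x‖)) := by
        rw [integral_const_mul]
        exact mul_le_mul_of_nonneg_left (hK y x) hM0
    _ = _ := by ring

theorem WeakConv.isConvFun_Rop {f : (Fin n → ℂ) → ℂ} (hf : Measurable f) {M : ℝ}
    (hM : ∀ z, ‖f z‖ ≤ M) {C : BOp n p t} (h : WeakConv f Rop C) : IsConvFun f Rop C := by
  obtain ⟨K, -, hK⟩ := exists_integral_norm_dual_shift_Rop_le n p t
  exact h.isConvFun hf.aestronglyMeasurable (norm_mul_dual_shift_Rop_le hM hK)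

theorem WeakConv.norm_le_Rop {f : (Fin n → ℂ) → ℂ} {M : ℝ}
    (hM : ∀ z, ‖f z‖ ≤ M) {K : ℝ} (hK0 : 0 ≤ K)
    (hK : ∀ (y : FockSpace n p t →L[ℂ] ℂ) (x : FockSpace n p t),
      ∫ z, ‖y (PFock.shift z Rop x)‖ ≤ K * (‖y‖ * ‖x‖)) {C : BOp n p t} (h : WeakConv f Rop C) :
    ‖C‖ ≤ M * K := by
  have hM0 : 0 ≤ M := (norm_nonneg _).trans (hM 0)
  refine norm_le_of_forall_dual (mul_nonneg hM0 hK0) fun y x => ?_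
  rw [(h y x).2, mul_assoc _ ‖y‖]
  exact (norm_integral_le_integral_norm _).trans (norm_mul_dual_shift_Rop_le hM hK y x)

/-! ### The convolution `R_t ∗ f` -/

theorem parity_comp_parity_comp (A : BOp n p t) :
    parity.comp ((parity.comp (A.comp parity)).comp parity) = A := by
  have h : ∀ x : FockSpace n p t, parity (parity x) = x := fun x =>
    FockSpace.ext fun w => congrArg x.1 (neg_neg w)
  ext1 x
  simp only [ContinuousLinearMap.comp_apply, h]

/-- The two conjugations by the parity operator cancel, so both convolutions are the same weak
integral. -/
theorem isConvOp_iff {A C : BOp n p t} {f : (Fin n → ℂ) → ℂ} :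
    IsConvOp A f C ↔ IsConvFun f A C := by
  unfold IsConvOp IsConvFun convOpOp
  simp only [parity_comp_parity_comp]

theorem weakConv_convOp {f : (Fin n → ℂ) → ℂ} (hf : f ∈ BUC n) :
    WeakConv f (Rop : BOp n p t) (convOp Rop f) := by
  obtain ⟨hu, M, hM⟩ := hf
  obtain ⟨C, hC⟩ := exists_weakConv_Rop (p := p) (t := t) hu.continuous.measurable hM
  have h : ∃ C : BOp n p t, IsConvOp Rop f C :=
    ⟨C, isConvOp_iff.2 (hC.isConvFun_Rop hu.continuous.measurable hM)⟩
  rw [convOp, dif_pos h]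
  exact (isConvOp_iff.1 h.choose_spec).weakConv

theorem existsUnique_isConvOp {f : (Fin n → ℂ) → ℂ} (hf : f ∈ BUC n) :
    ∃! C : BOp n p t, IsConvOp Rop f C := by
  have h : WeakConv f (Rop : BOp n p t) (convOp Rop f) := weakConv_convOp hf
  obtain ⟨hu, M, hM⟩ := hf
  exact ⟨_, isConvOp_iff.2 (h.isConvFun_Rop hu.continuous.measurable hM),
    fun C' h' => (isConvOp_iff.1 h').weakConv.unique h⟩

/-- The difference of two shifts of `R_t ∗ f` is the convolution of `R_t` with the difference of two
translates of `f`, and its norm is at most `K` times the supremum of that difference. -/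
theorem convOp_mem_C1 {f : (Fin n → ℂ) → ℂ} (hf : f ∈ BUC n) :
    (convOp Rop f : BOp n p t) ∈ C1 n p t := by
  obtain ⟨K, hK0, hK⟩ := exists_integral_norm_dual_shift_Rop_le n p t
  have h := weakConv_convOp (p := p) (t := t) hf
  change Continuous fun w => shift w (convOp Rop f : BOp n p t)
  rw [Metric.continuous_iff]
  intro w₀ ε hε
  -- The denominator `K + 1` covers `K = 0` and makes the final inequality strict.
  obtain ⟨δ, hδ, hfδ⟩ := Metric.uniformContinuous_iff.1 hf.1 (ε / (K + 1)) (by positivity)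
  refine ⟨δ, hδ, fun w hw => ?_⟩
  have h1 := (h.shift w).add ((h.shift w₀).smul (-1))
  have h2 := h1.norm_le_Rop (M := ε / (K + 1)) (fun z => by
    rw [neg_one_mul, ← sub_eq_add_neg, ← dist_eq_norm]
    refine (hfδ ?_).le
    rwa [dist_sub_left]) hK0 hK
  rw [neg_one_smul, ← sub_eq_add_neg, ← dist_eq_norm] at h2
  refine h2.trans_lt ?_
  rw [div_mul_eq_mul_div, div_lt_iff₀ (by positivity)]
  nlinarith

/-! ### The Toeplitz formula -/

theorem evalCLM_shift_Rop (z w : Fin n → ℂ) (h : FockSpace n p t) :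
    evalCLM w (shift z Rop h) = ((gauss n t z : ℝ) : ℂ) *
      (Complex.exp (hdot w z / (t : ℂ)) * h z) := by
  have ht0 : (t : ℂ) ≠ 0 := by exact_mod_cast ht.out.ne'
  have e : ((gauss n t z : ℝ) : ℂ) * Complex.exp (hdot w z / (t : ℂ)) =
      ((1 / (Real.pi * t) ^ n : ℝ) : ℂ) * (((weight t z : ℝ) : ℂ) * nkernel t z w) := by
    rw [gauss, weight, nkernel, Complex.ofReal_mul, mul_assoc, Complex.ofReal_exp,
      Complex.ofReal_exp, ← Complex.exp_add, ← Complex.exp_add]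
    congr 2
    push_cast
    field_simp
    ring
  rw [dual_shift_Rop, ropCoeff, evalCLM_apply, kvec_apply]
  linear_combination (-(h z)) * e

theorem integrable_gaussMeasure_iff {s : ℝ} (hs : 0 < s) {F : (Fin n → ℂ) → ℂ} :
    Integrable F (gaussMeasure n s) ↔ Integrable fun z => ((gauss n s z : ℝ) : ℂ) * F z := by
  rw [gaussMeasure, integrable_withDensity_iff_integrable_smul₀'
    (measurable_density n s).aemeasurable (Eventually.of_forall fun _ => ENNReal.ofReal_lt_top)]
  refine integrable_congr (Eventually.of_forall fun z => ?_)
  simp only [ENNReal.toReal_ofReal (gauss_pos n hs z).le, Complex.real_smul]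

theorem integral_gaussMeasure {s : ℝ} (hs : 0 < s) (F : (Fin n → ℂ) → ℂ) :
    ∫ z, F z ∂gaussMeasure n s = ∫ z, ((gauss n s z : ℝ) : ℂ) * F z := by
  rw [gaussMeasure, integral_withDensity_eq_integral_toReal_smul (measurable_density n s)
    (Eventually.of_forall fun _ => ENNReal.ofReal_lt_top)]
  refine integral_congr_ae (Eventually.of_forall fun z => ?_)
  simp only [ENNReal.toReal_ofReal (gauss_pos n hs z).le, Complex.real_smul]

theorem WeakConv.isToeplitz {f : (Fin n → ℂ) → ℂ} {C : BOp n p t} (h : WeakConv f Rop C) :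
    IsToeplitz f C := by
  intro x w
  have h1 := h (evalCLM w) x
  simp only [evalCLM_shift_Rop] at h1
  have e : ∀ z, f z * (((gauss n t z : ℝ) : ℂ) * (Complex.exp (hdot w z / (t : ℂ)) * x z)) =
      ((gauss n t z : ℝ) : ℂ) * (Complex.exp (hdot w z / (t : ℂ)) * (f z * x z)) := fun z => by ring
  simp only [e] at h1
  rw [integrable_gaussMeasure_iff ht.out, integral_gaussMeasure ht.out]
  exact h1

end Space

/-- Puts zeros on a real interval into the form required by the identity theorem. -/
theorem frequently_ofReal {f : ℂ → ℂ} {c : ℝ} (h : ∀ᶠ x : ℝ in 𝓝 c, f x = 0) :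
    ∃ᶠ z in 𝓝[≠] (c : ℂ), f z = 0 := by
  have ht : Tendsto (fun x : ℝ => (x : ℂ)) (𝓝[≠] c) (𝓝[≠] (c : ℂ)) :=
    tendsto_nhdsWithin_of_tendsto_nhds_of_eventually_within _
      ((Complex.continuous_ofReal.tendsto c).mono_left nhdsWithin_le_nhds)
      (by
        filter_upwards [self_mem_nhdsWithin] with x hx
        simpa using hx)
  exact ht.frequently (h.filter_mono nhdsWithin_le_nhds).frequently

section Space

variable {n : ℕ} {p t : ℝ} [hp : Fact (1 < p)] [ht : Fact (0 < t)]

/-! ### The reproducing formula -/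

theorem measurePreserving_rotate {c : ℂ} (hc : ‖c‖ = 1) :
    MeasurePreserving (fun (z : Fin n → ℂ) i => c * z i) volume volume :=
  volume_preserving_pi (fun _ =>
    (rotation ⟨c, mem_sphere_zero_iff_norm.2 hc⟩).measurePreserving)

theorem norm_gauss_mul_le (f : FockSpace n p t) (z w : Fin n → ℂ) (h : sqNorm w = sqNorm z) :
    ‖((gauss n t z : ℝ) : ℂ) * f w‖ ≤ 2 ^ n * gauss n (2 * t) z * ‖f‖ := by
  have ht0 := ht.out
  have e : gauss n t z * Real.exp (sqNorm z / (2 * t)) = 2 ^ n * gauss n (2 * t) z := by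
    rw [gauss, gauss, mul_assoc, ← Real.exp_add, ← mul_assoc]
    congr 1
    · rw [mul_pow, mul_pow, mul_pow]; field_simp
    · congr 1; field_simp; ring
  rw [norm_mul, Complex.norm_real, Real.norm_of_nonneg (gauss_pos n ht0 z).le, ← e, mul_assoc, ← h]
  exact mul_le_mul_of_nonneg_left (norm_apply_le w f) (gauss_pos n ht0 z).le

theorem integral_gauss_mul_rotate (f : FockSpace n p t) {c : ℂ} (hc : ‖c‖ = 1) :
    ∫ z, ((gauss n t z : ℝ) : ℂ) * f (fun i => c * z i) =
      ∫ z, ((gauss n t z : ℝ) : ℂ) * f z := by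
  have hm := measurePreserving_rotate (n := n) hc
  have hcont : Continuous fun z => ((gauss n t z : ℝ) : ℂ) * f z :=
    (Complex.continuous_ofReal.comp (continuous_gauss n t)).mul f.2.1.continuous
  have h := integral_map (μ := (volume : Measure (Fin n → ℂ))) hm.measurable.aemeasurable
    (f := fun z => ((gauss n t z : ℝ) : ℂ) * f z) hcont.aestronglyMeasurable
  rw [hm.map_eq] at h
  rw [h]
  simp only [gauss_rotate t hc]

theorem sqNorm_rotate {c : ℂ} (hc : ‖c‖ = 1) (z : Fin n → ℂ) :
    sqNorm (fun i => c * z i) = sqNorm z := by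
  simp [sqNorm, hc]

theorem integral_circleMap (f : FockSpace n p t) (z : Fin n → ℂ) :
    ∫ θ in (0 : ℝ)..2 * Real.pi, f (fun i => circleMap 0 1 θ * z i) = (2 * Real.pi : ℝ) • f 0 := by
  have hd : Differentiable ℂ (fun l : ℂ => f.1 (fun i => l * z i)) :=
    f.2.1.comp (by fun_prop)
  have h := (hd.diffContOnCl (s := Metric.ball 0 |1|)).circleAverage
  have h0 : f 0 = f.1 (fun i => (0 : ℂ) * z i) := by
    refine congrArg f.1 ?_; funext i; simp
  rw [h0, ← h, Real.circleAverage, smul_smul, mul_inv_cancel₀ (by positivity), one_smul]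

/-- Average over the rotations `z ↦ e^{iθ} z`, which preserve the Gaussian, and use the mean value
property on each complex line through `0`. -/
theorem integral_gauss_mul (f : FockSpace n p t) :
    ∫ z, ((gauss n t z : ℝ) : ℂ) * f z = f 0 := by
  have ht0 := ht.out
  have hc : ∀ θ : ℝ, ‖circleMap 0 1 θ‖ = 1 := fun θ => by simp
  have hcont : Continuous fun q : ℝ × (Fin n → ℂ) =>
      ((gauss n t q.2 : ℝ) : ℂ) * f (fun i => circleMap 0 1 q.1 * q.2 i) := by
    have h1 := (continuous_gauss n t).comp (continuous_snd (X := ℝ))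
    have h2 := continuous_circleMap 0 1
    exact (Complex.continuous_ofReal.comp h1).mul (f.2.1.continuous.comp (by fun_prop))
  have hswap := intervalIntegral_integral_swap (a := 0) (b := 2 * Real.pi)
    (μ := (volume : Measure (Fin n → ℂ)))
    (f := fun θ z => ((gauss n t z : ℝ) : ℂ) * f (fun i => circleMap 0 1 θ * z i)) (by
      -- The majorant for Fubini: the growth `e^{|z|²/(2t)}` of `f` uses up half of the exponent of
      -- `f_t`.
      have hb : Integrable fun z : Fin n → ℂ => 2 ^ n * gauss n (2 * t) z * ‖f‖ :=
        ((integrable_gauss n (by positivity)).const_mul _).mul_const _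
      have : IsFiniteMeasure ((volume : Measure ℝ).restrict (Set.uIoc 0 (2 * Real.pi))) := by
        rw [Set.uIoc_of_le (by positivity)]; infer_instance
      refine (hb.comp_snd (volume.restrict (Set.uIoc 0 (2 * Real.pi)))).mono'
        hcont.aestronglyMeasurable (Eventually.of_forall fun q => ?_)
      exact norm_gauss_mul_le f q.2 _ (sqNorm_rotate (hc q.1) q.2))
  simp only [integral_gauss_mul_rotate f (hc _), intervalIntegral.integral_const_mul,
    integral_circleMap, intervalIntegral.integral_const] at hswap
  rw [integral_mul_const, integral_complex_ofReal, integral_gauss n ht0, sub_zero,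
    Complex.ofReal_one, one_mul] at hswap
  exact smul_right_injective ℂ (by positivity : (2 * Real.pi : ℝ) ≠ 0) hswap

theorem two_re_sub (a b : Fin n → ℂ) : ((2 * (hdot a b).re : ℝ) : ℂ) - hdot a b = hdot b a := by
  have h1 := hdot_comm_im a b
  have h2 : (hdot b a).re = (hdot a b).re := by
    unfold hdot
    rw [Complex.re_sum, Complex.re_sum]
    refine Finset.sum_congr rfl fun i _ => ?_
    simp only [Complex.mul_re, Complex.conj_re, Complex.conj_im]
    ring
  apply Complex.ext
  · simp [h2]; ring
  · simp [h1]

theorem gauss_sub_mul_nkernel (z w : Fin n → ℂ) :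
    ((gauss n t (z - w) : ℝ) : ℂ) * nkernel t (-w) (z - w) =
      ((weight t w : ℝ) : ℂ) * (((gauss n t z : ℝ) : ℂ) * Complex.exp (hdot w z / (t : ℂ))) := by
  have ht0 : (t : ℂ) ≠ 0 := by exact_mod_cast ht.out.ne'
  rw [gauss, gauss, weight, nkernel, hdot_neg_right, hdot_sub_left, hdot_self, sqNorm_neg,
    sqNorm_sub, ← two_re_sub z w]
  simp only [Complex.ofReal_mul, Complex.ofReal_exp]
  rw [mul_assoc, mul_assoc, mul_left_comm (Complex.exp _)]
  rw [← Complex.exp_add, ← Complex.exp_add, ← Complex.exp_add]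
  congr 2
  push_cast
  field_simp
  ring

/-- The formula at the origin, applied to `W_{-w} f` and translated by `w`. -/
theorem integral_reproducing (f : FockSpace n p t) (w : Fin n → ℂ) :
    ∫ z, ((gauss n t z : ℝ) : ℂ) * (Complex.exp (hdot w z / (t : ℂ)) * f z) = f w := by
  have h := integral_gauss_mul (weyl (-w) f)
  rw [← integral_sub_right_eq_self (fun z => ((gauss n t z : ℝ) : ℂ) * (weyl (-w) f) z) w] at h
  simp only [weyl_apply, sub_neg_eq_add, sub_add_cancel, zero_add, ← mul_assoc] at h
  simp only [gauss_sub_mul_nkernel, mul_assoc] at h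
  rw [integral_const_mul] at h
  have e : nkernel t (-w) 0 = ((weight t w : ℝ) : ℂ) := by
    rw [nkernel, hdot_zero_left, sqNorm_neg, weight, Complex.ofReal_exp]
    simp
  rw [e] at h
  exact mul_left_cancel₀ (by exact_mod_cast (weight_pos w).ne') h

theorem const_mem_BUC (n : ℕ) (c : ℂ) : (fun _ => c) ∈ BUC n :=
  ⟨uniformContinuous_const, ‖c‖, fun _ => le_rfl⟩

theorem convOp_one : (convOp Rop (fun _ => 1) : BOp n p t) = ContinuousLinearMap.id ℂ _ := by
  ext1 x
  refine FockSpace.ext fun w => ?_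
  have h := ((weakConv_convOp (p := p) (t := t) (const_mem_BUC n 1)) (evalCLM w) x).2
  simp only [one_mul, evalCLM_shift_Rop, integral_reproducing] at h
  exact h

/-- Totality of the kernel vectors: since `R_t ∗ 1` is the identity, `x` is a weak integral of
multiples of `k_z`. -/
theorem eq_zero_of_dual_kvec {y : FockSpace n p t →L[ℂ] ℂ} (h : ∀ z, y (kvec z) = 0)
    (x : FockSpace n p t) : y x = 0 := by
  have h1 := ((weakConv_convOp (p := p) (t := t) (const_mem_BUC n 1)) y x).2
  simpa [convOp_one, dual_shift_Rop, h] using h1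

theorem eq_zero_of_apply_kvec {A : BOp n p t} (h : ∀ z, A (kvec z) = 0) : A = 0 :=
  ext_dual fun y x => by
    have := eq_zero_of_dual_kvec (y := y.comp A) (fun z => by simp [h]) x
    simpa using this

/-! ### Holomorphic families of vectors -/

/-- The vector valued Cauchy integral of a continuous `G` is analytic inside the circle, and by the
scalar Cauchy formula its point evaluations are those of `G`. -/
theorem differentiable_of_eval {G : ℂ → FockSpace n p t} (hG : Continuous G)
    (hd : ∀ u, Differentiable ℂ fun ζ => G ζ u) : Differentiable ℂ G := by
  intro ζ₀
  let R : NNReal := 1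
  have hps := hasFPowerSeriesOn_cauchy_integral (f := G) (c := ζ₀) (R := R)
    (hG.continuousOn.circleIntegrable zero_le_one) one_pos
  have hda := hps.analyticAt.differentiableAt
  refine hda.congr_of_eventuallyEq ?_
  filter_upwards [Metric.ball_mem_nhds ζ₀ one_pos] with ζ hζ
  refine FockSpace.ext fun u => ?_
  have hne : ∀ z ∈ Metric.sphere ζ₀ (R : ℝ), z - ζ ≠ 0 := by
    intro z hz h0
    rw [sub_eq_zero] at h0
    subst h0
    have h1 : dist z ζ₀ = 1 := hz
    have h2 : dist z ζ₀ < 1 := hζ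
    linarith
  have hci : CircleIntegrable (fun z => (z - ζ)⁻¹ • G z) ζ₀ R :=
    ContinuousOn.circleIntegrable zero_le_one
      (((continuous_id.sub continuous_const).continuousOn.inv₀ hne).smul hG.continuousOn)
  have h1 := (evalCLM u).intervalIntegral_comp_comm hci.out
  have h2 := (hd u).diffContOnCl.two_pi_i_inv_smul_circleIntegral_sub_inv_smul hζ
  rw [← evalCLM_apply, ← evalCLM_apply, map_smul]
  unfold circleIntegral at h2 ⊢
  rw [← h1]
  simp only [map_smul, evalCLM_apply]
  exact h2.symm

/-- Write `F ζ (w ζ)` as `(ζ - ζ₀) ψ(ζ) + F ζ₀ (w ζ)` with `ψ` the evaluated difference quotient;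
continuity of `ψ` at `ζ₀` is enough to differentiate the product there. -/
theorem differentiable_eval_comp {F : ℂ → FockSpace n p t} {w : ℂ → Fin n → ℂ}
    (hF : Differentiable ℂ F) (hw : Differentiable ℂ w) : Differentiable ℂ fun ζ => F ζ (w ζ) := by
  intro ζ₀
  have hcont : Continuous (dslope F ζ₀) := by
    rw [continuous_iff_continuousAt]
    intro ζ
    by_cases h : ζ = ζ₀
    · rw [h]
      exact continuousAt_dslope_same.2 (hF ζ₀)
    · exact (continuousAt_dslope_of_ne h).2 (hF ζ).continuousAt
  have hψ : Continuous fun ζ => (dslope F ζ₀ ζ) (w ζ) := continuous_eval hw.continuous hcont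
  have h1 : HasDerivAt (fun ζ => (ζ - ζ₀) * (dslope F ζ₀ ζ) (w ζ)) ((dslope F ζ₀ ζ₀) (w ζ₀)) ζ₀ := by
    rw [hasDerivAt_iff_tendsto_slope]
    refine ((hψ.tendsto ζ₀).mono_left nhdsWithin_le_nhds).congr' ?_
    filter_upwards [self_mem_nhdsWithin] with ζ hζ
    have hne : ζ - ζ₀ ≠ 0 := sub_ne_zero.2 hζ
    rw [slope_def_field, sub_self, zero_mul, sub_zero]
    field_simp
  have h2 : DifferentiableAt ℂ (fun ζ => (F ζ₀) (w ζ)) ζ₀ := ((F ζ₀).2.1.comp hw) ζ₀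
  refine (h1.differentiableAt.add h2).congr_of_eventuallyEq (Eventually.of_forall fun ζ => ?_)
  have h3 := sub_smul_dslope F ζ₀ ζ
  have h4 := congrArg (fun f : FockSpace n p t => f (w ζ)) h3
  have h5 : (ζ - ζ₀) * (dslope F ζ₀ ζ) (w ζ) = F ζ (w ζ) - F ζ₀ (w ζ) := h4
  simp only [Pi.add_apply]
  rw [h5]
  ring

/-! ### Injectivity of the Berezin transform -/

/-- The reproducing kernel `K_v(u) = exp (u · v̄ / t)` as an element of `F_t^p`. -/
def repKernel (v : Fin n → ℂ) : FockSpace n p t :=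
  ((Real.exp (sqNorm v / (2 * t)) : ℝ) : ℂ) • kvec v

theorem repKernel_apply (v u : Fin n → ℂ) :
    (repKernel v : FockSpace n p t) u = Complex.exp (hdot u v / (t : ℂ)) := by
  change ((Real.exp (sqNorm v / (2 * t)) : ℝ) : ℂ) * (kvec v : FockSpace n p t) u = _
  rw [kvec_apply, nkernel, Complex.ofReal_exp, ← Complex.exp_add]
  congr 1
  ring

theorem continuous_repKernel : Continuous (repKernel : (Fin n → ℂ) → FockSpace n p t) := by
  have := continuous_sqNorm (n := n)
  have h : Continuous fun v : Fin n → ℂ => ((Real.exp (sqNorm v / (2 * t)) : ℝ) : ℂ) :=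
    Complex.continuous_ofReal.comp (Real.continuous_exp.comp (this.div_const _))
  exact h.smul continuous_kvec

/-- The function `(C K_v)(w)` is holomorphic in `w` and antiholomorphic in `v`, hence determined by
the diagonal. One complex parameter suffices to join a given pair `(v, w)` to the diagonal. -/
theorem eq_zero_of_diagonal {C : BOp n p t} (h : ∀ v, C (kvec v) v = 0) : C = 0 := by
  have hrep : ∀ v, C (repKernel v) v = 0 := fun v => by
    rw [repKernel, map_smul]
    change _ * C (kvec v) v = 0
    rw [h, mul_zero]
  refine eq_zero_of_apply_kvec fun v => FockSpace.ext fun w => ?_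
  suffices hs : C (repKernel v) w = 0 by
    rw [repKernel, map_smul] at hs
    have hs' : ((Real.exp (sqNorm v / (2 * t)) : ℝ) : ℂ) * C (kvec v) w = 0 := hs
    rcases mul_eq_zero.1 hs' with h0 | h0
    · exact absurd h0 (by exact_mod_cast (Real.exp_pos _).ne')
    · exact h0
  -- The points `m + iζ d` and `m + i ζ̄ d` coincide for real `ζ`, and are `w` and `v` for `ζ = -i`.
  -- The conjugate in the second makes the composition holomorphic in `ζ`.
  let m : Fin n → ℂ := (1 / 2 : ℂ) • (w + v)
  let d : Fin n → ℂ := (1 / 2 : ℂ) • (w - v)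
  let wp : ℂ → Fin n → ℂ := fun ζ => m + (ζ * Complex.I) • d
  let vp : ℂ → Fin n → ℂ := fun ζ => m + ((starRingEnd ℂ) ζ * Complex.I) • d
  have hvp : Continuous vp := by
    have := Complex.continuous_conj
    fun_prop
  have hG : Differentiable ℂ fun ζ => (repKernel (vp ζ) : FockSpace n p t) := by
    refine differentiable_of_eval (continuous_repKernel.comp hvp) fun u => ?_
    simp only [repKernel_apply]
    have e : ∀ ζ, hdot u (vp ζ) = hdot u m - ζ * Complex.I * hdot u d := by
      intro ζ
      rw [hdot_add_right, sub_eq_add_neg]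
      congr 1
      simp only [hdot, Finset.mul_sum, ← Finset.sum_neg_distrib]
      refine Finset.sum_congr rfl fun i _ => ?_
      simp only [Pi.smul_apply, smul_eq_mul, map_mul, Complex.conj_conj, Complex.conj_I]
      ring
    simp only [e]
    fun_prop
  have hF : Differentiable ℂ fun ζ => C (repKernel (vp ζ)) := C.differentiable.comp hG
  have hh : Differentiable ℂ fun ζ => C (repKernel (vp ζ)) (wp ζ) :=
    differentiable_eval_comp hF (by fun_prop)
  have hz := (hh.differentiableOn.analyticOnNhd isOpen_univ).eqOn_zero_of_preconnected_of_frequently_eq_zero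
    isPreconnected_univ (Set.mem_univ ((0 : ℝ) : ℂ)) (frequently_ofReal (Eventually.of_forall fun x => by
      have : vp (x : ℂ) = wp (x : ℂ) := by simp only [vp, wp, Complex.conj_ofReal]
      rw [this]
      exact hrep _))
  have h1 := hz (Set.mem_univ (-Complex.I))
  have e1 : wp (-Complex.I) = w := by
    funext i
    simp [wp, m, d]
    ring
  have e2 : vp (-Complex.I) = v := by
    funext i
    simp [vp, m, d]
    ring
  simp only [e1, e2] at h1
  exact h1

/-! ### The Berezin transform -/

/-- The Berezin transform of a bounded operator. -/
def berezin (A : BOp n p t) (v : Fin n → ℂ) : ℂ := evalCLM 0 (shift (-v) A fockOne)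

theorem berezin_eq (A : BOp n p t) (v : Fin n → ℂ) :
    berezin A v = ((weight t v : ℝ) : ℂ) * A (kvec v) v := by
  rw [berezin, evalCLM_apply, shift_apply, weyl_apply, neg_neg, zero_sub, neg_neg, nkernel,
    hdot_zero_left, sqNorm_neg, weight, Complex.ofReal_exp, kvec]
  simp

theorem eq_of_berezin_eq {A B : BOp n p t} (h : ∀ v, berezin A v = berezin B v) : A = B := by
  refine sub_eq_zero.1 (eq_zero_of_diagonal fun v => ?_)
  have h1 := h v
  rw [berezin_eq, berezin_eq] at h1
  have h2 := mul_left_cancel₀ (by exact_mod_cast (weight_pos v).ne') h1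
  change A (kvec v) v - B (kvec v) v = 0
  rw [h2, sub_self]

/-- The Berezin transform tests shifted operators against a fixed functional and vector, so it turns
operator convolution into convolution of functions. -/
theorem WeakConv.berezin {g : (Fin n → ℂ) → ℂ} {A C : BOp n p t} (h : WeakConv g A C)
    (v : Fin n → ℂ) : PFock.berezin C v = ∫ z, g (z + v) * PFock.berezin A (-z) := by
  have h1 := ((h.shift (-v)) (evalCLM 0) fockOne).2
  simpa only [sub_neg_eq_add, PFock.berezin, neg_neg] using h1

theorem berezin_Rop (v : Fin n → ℂ) : berezin (Rop : BOp n p t) v = ((gauss n t v : ℝ) : ℂ) := by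
  rw [berezin, evalCLM_shift_Rop, hdot_zero_left]
  have : (fockOne : FockSpace n p t) (-v) = 1 := rfl
  rw [this]
  simp [gauss, sqNorm_neg]

/-- For an isometric action, continuity of the orbit at `0` is already uniform continuity. -/
theorem berezin_mem_BUC {A : BOp n p t} (hA : A ∈ C1 n p t) : berezin A ∈ BUC n := by
  let ℓ : BOp n p t →L[ℂ] ℂ := (evalCLM 0).comp (ContinuousLinearMap.apply ℂ _ fockOne)
  have hu : UniformContinuous fun z => shift z A := by
    rw [Metric.uniformContinuous_iff]
    intro ε hε
    have hA' : Continuous fun z => shift z A := hA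
    obtain ⟨δ, hδ, h⟩ := Metric.continuous_iff.1 hA' 0 ε hε
    refine ⟨δ, hδ, fun {a b} hab => ?_⟩
    have e : shift a A - shift b A = shiftL b (shift (a - b) A - shift 0 A) := by
      rw [map_sub, shiftL_apply, shiftL_apply, ← shift_add, ← shift_add]
      simp
    rw [dist_eq_norm, e]
    refine (norm_shift_le b _).trans_lt ?_
    rw [← dist_eq_norm]
    refine h _ ?_
    rwa [dist_zero_right, ← dist_eq_norm]
  refine ⟨ℓ.uniformContinuous.comp (hu.comp uniformContinuous_neg), ‖ℓ‖ * ‖A‖, fun v => ?_⟩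
  exact (ℓ.le_opNorm _).trans (mul_le_mul_of_nonneg_left (norm_shift_le _ A) (norm_nonneg _))

theorem gauss_neg (s : ℝ) (z : Fin n → ℂ) : gauss n s (-z) = gauss n s z := by
  simp [gauss, sqNorm_neg]

/-- The Berezin transform of `R_t` is `f_t`, so both sides have the convolution of `f_t` with
`berezin A` as Berezin transform, and injectivity applies. -/
theorem convFun_gauss_eq_convOp {A : BOp n p t} (hA : A ∈ C1 n p t) :
    convFun (fun z => ((gauss n t z : ℝ) : ℂ)) A = convOp Rop (berezin A) := by
  refine eq_of_berezin_eq fun v => ?_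
  rw [(weakConv_convFun (integrable_gauss_complex n ht.out) A).berezin,
    (weakConv_convOp (berezin_mem_BUC hA)).berezin]
  simp only [berezin_Rop, gauss_neg]
  rw [← integral_sub_left_eq_self (fun z => berezin A (z + v) * ((gauss n t z : ℝ) : ℂ)) volume (-v)]
  refine integral_congr_ae (Eventually.of_forall fun z => ?_)
  have e1 : -v - z + v = -z := by abel
  have e2 : -v - z = -(z + v) := by abel
  simp only [e1]
  rw [e2, gauss_neg, mul_comm]

end Space

/-! ### Bounded functions annihilated by all translates of a Gaussian -/

section Gaussian

variable {n : ℕ}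

theorem hdot_smul_right_re (c : ℝ) (v w : Fin n → ℂ) : (hdot v (c • w)).re = c * (hdot v w).re := by
  unfold hdot
  rw [Complex.re_sum, Complex.re_sum, Finset.mul_sum]
  refine Finset.sum_congr rfl fun i _ => ?_
  simp only [Pi.smul_apply, Complex.mul_re, Complex.conj_re, Complex.conj_im, Complex.smul_re,
    Complex.smul_im, smul_eq_mul]
  ring

theorem hdot_comm_re (v w : Fin n → ℂ) : (hdot v w).re = (hdot w v).re := by
  unfold hdot
  rw [Complex.re_sum, Complex.re_sum]
  refine Finset.sum_congr rfl fun i _ => ?_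
  simp only [Complex.mul_re, Complex.conj_re, Complex.conj_im]
  ring

theorem sqNorm_real_smul (c : ℝ) (w : Fin n → ℂ) : sqNorm (c • w) = c ^ 2 * sqNorm w := by
  simp only [sqNorm, Finset.mul_sum]
  refine Finset.sum_congr rfl fun i _ => ?_
  rw [Pi.smul_apply, norm_smul, mul_pow, Real.norm_eq_abs, sq_abs]

theorem sqNorm_nonneg (w : Fin n → ℂ) : 0 ≤ sqNorm w :=
  Finset.sum_nonneg fun _ _ => sq_nonneg _

/-- Completing the square in `v`; integration in `v` then gives the semigroup law of the Gaussians.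
-/
theorem gauss_mul_gauss {r s : ℝ} (hr : 0 < r) (hs : 0 < s) (v w : Fin n → ℂ) :
    gauss n r v * gauss n s (w - v) =
      gauss n (r + s) w * gauss n (r * s / (r + s)) (v - (r / (r + s)) • w) := by
  have hrs : 0 < r + s := by positivity
  unfold gauss
  rw [mul_mul_mul_comm, mul_mul_mul_comm (1 / (Real.pi * (r + s)) ^ n), ← Real.exp_add,
    ← Real.exp_add, sqNorm_sub, sqNorm_sub, hdot_smul_right_re, sqNorm_real_smul, hdot_comm_re w v]
  congr 1
  · rw [div_mul_div_comm, div_mul_div_comm, ← mul_pow, ← mul_pow]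
    congr 2
    field_simp
  · congr 1
    field_simp
    ring

theorem integral_gauss_mul_gauss {r s : ℝ} (hr : 0 < r) (hs : 0 < s) (w : Fin n → ℂ) :
    ∫ v, gauss n r v * gauss n s (w - v) = gauss n (r + s) w := by
  simp only [gauss_mul_gauss hr hs]
  rw [integral_const_mul, integral_sub_right_eq_self (fun v => gauss n (r * s / (r + s)) v),
    integral_gauss n (by positivity), mul_one]

/-- By the semigroup law `f_{r+s}` is an average of translates of `f_s`, each of which annihilates
`ψ`. -/
theorem integral_gauss_add_eq_zero {s : ℝ} (hs : 0 < s) {ψ : (Fin n → ℂ) → ℂ} (hψ : Continuous ψ)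
    {M : ℝ} (hM : ∀ z, ‖ψ z‖ ≤ M)
    (h : ∀ v, ∫ z, ((gauss n s z : ℝ) : ℂ) * ψ (z + v) = 0) {r : ℝ} (hr : 0 < r) :
    ∫ w, ((gauss n (r + s) w : ℝ) : ℂ) * ψ w = 0 := by
  have hint : Integrable (fun q : (Fin n → ℂ) × (Fin n → ℂ) =>
      gauss n r q.2 * gauss n s (q.1 - q.2)) (volume.prod volume) :=
    (integrable_gauss n hr).convolution_integrand (ContinuousLinearMap.mul ℝ ℝ)
      (integrable_gauss n hs)
  have hint2 : Integrable (Function.uncurry fun w v : Fin n → ℂ =>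
      ((gauss n r v * gauss n s (w - v) : ℝ) : ℂ) * ψ w) (volume.prod volume) := by
    refine (hint.mul_const M).mono' ?_ (Eventually.of_forall fun q => ?_)
    · have h1 := continuous_gauss n r
      have h2 := continuous_gauss n s
      refine Continuous.aestronglyMeasurable ?_
      unfold Function.uncurry
      fun_prop
    · have hp : 0 ≤ gauss n r q.2 * gauss n s (q.1 - q.2) :=
        mul_nonneg (gauss_pos n hr _).le (gauss_pos n hs _).le
      simp only [Function.uncurry, norm_mul ((_ : ℝ) : ℂ), Complex.norm_real]
      rw [Real.norm_of_nonneg hp]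
      exact mul_le_mul_of_nonneg_left (hM _) hp
  calc ∫ w, ((gauss n (r + s) w : ℝ) : ℂ) * ψ w
      = ∫ w, ∫ v, ((gauss n r v * gauss n s (w - v) : ℝ) : ℂ) * ψ w := by
        refine integral_congr_ae (Eventually.of_forall fun w => ?_)
        simp only
        rw [integral_mul_const, integral_complex_ofReal, integral_gauss_mul_gauss hr hs]
    _ = ∫ v, ∫ w, ((gauss n r v * gauss n s (w - v) : ℝ) : ℂ) * ψ w := integral_integral_swap hint2
    _ = ∫ _ : Fin n → ℂ, (0 : ℂ) := by
        refine integral_congr_ae (Eventually.of_forall fun v => ?_)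
        simp only [Complex.ofReal_mul, mul_assoc]
        rw [integral_const_mul, ← integral_add_right_eq_self _ v]
        simp only [add_sub_cancel_right]
        rw [h, mul_zero]
    _ = 0 := integral_zero _ _

theorem exp_eq_gauss {s : ℝ} (hs : 0 < s) (w : Fin n → ℂ) :
    Real.exp (-(s⁻¹ * sqNorm w)) = (Real.pi * s) ^ n * gauss n s w := by
  rw [gauss, ← mul_assoc, mul_one_div_cancel (by positivity), one_mul]
  congr 1
  field_simp

theorem integrable_exp_neg_mul_sqNorm {a : ℝ} (ha : 0 < a) :
    Integrable fun w : Fin n → ℂ => Real.exp (-(a * sqNorm w)) := by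
  have h : ∀ w : Fin n → ℂ, Real.exp (-(a * sqNorm w)) =
      (Real.pi * a⁻¹) ^ n * gauss n a⁻¹ w := fun w => by
    rw [← exp_eq_gauss (inv_pos.2 ha), inv_inv]
  simp only [h]
  exact (integrable_gauss n (inv_pos.2 ha)).const_mul _

theorem differentiableOn_laplace {ψ : (Fin n → ℂ) → ℂ} (hψ : Continuous ψ)
    {M : ℝ} (hM : ∀ z, ‖ψ z‖ ≤ M) :
    DifferentiableOn ℂ (fun u : ℂ => ∫ w, Complex.exp (-(u * ((sqNorm w : ℝ) : ℂ))) * ψ w)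
      {u | 0 < u.re} := by
  intro u₀ hu₀
  have hu₀ : 0 < u₀.re := hu₀
  have hM0 : 0 ≤ M := (norm_nonneg _).trans (hM 0)
  set ε : ℝ := u₀.re / 2 with hε
  have hε0 : 0 < ε := by positivity
  have hsq : Continuous fun w : Fin n → ℂ => ((sqNorm w : ℝ) : ℂ) :=
    Complex.continuous_ofReal.comp continuous_sqNorm
  have hnorm : ∀ (u : ℂ) (w : Fin n → ℂ), ‖Complex.exp (-(u * ((sqNorm w : ℝ) : ℂ)))‖ =
      Real.exp (-(u.re * sqNorm w)) := fun u w => by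
    rw [Complex.norm_exp, Complex.neg_re, Complex.re_mul_ofReal]
  have hball : ∀ u ∈ Metric.ball u₀ ε, ε ≤ u.re := by
    intro u hu
    have h1 : ‖u - u₀‖ < ε := by rwa [← dist_eq_norm]
    have h2 := (Complex.abs_re_le_norm (u - u₀)).trans_lt h1
    rw [Complex.sub_re, abs_lt] at h2
    linarith [h2.1]
  have key := hasDerivAt_integral_of_dominated_loc_of_deriv_le
    (μ := (volume : Measure (Fin n → ℂ))) (s := Metric.ball u₀ ε) (x₀ := u₀)
    (F := fun u w => Complex.exp (-(u * ((sqNorm w : ℝ) : ℂ))) * ψ w)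
    (F' := fun u w => Complex.exp (-(u * ((sqNorm w : ℝ) : ℂ))) * (-((sqNorm w : ℝ) : ℂ)) * ψ w)
    -- Half of the decay `e^{-ε|w|²}` absorbs the factor `|w|²` produced by differentiation.
    (bound := fun w => (2 / ε) * Real.exp (-(ε / 2 * sqNorm w)) * M)
    (Metric.ball_mem_nhds u₀ hε0)
    (Eventually.of_forall fun u => Continuous.aestronglyMeasurable (by fun_prop))
    ((integrable_exp_neg_mul_sqNorm hu₀).mul_const M |>.mono'
      (Continuous.aestronglyMeasurable (by fun_prop)) (Eventually.of_forall fun w => by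
        rw [norm_mul, hnorm]
        exact mul_le_mul_of_nonneg_left (hM w) (Real.exp_pos _).le))
    (Continuous.aestronglyMeasurable (by fun_prop))
    (Eventually.of_forall fun w u hu => by
      rw [norm_mul, norm_mul, hnorm, norm_neg, Complex.norm_real,
        Real.norm_of_nonneg (sqNorm_nonneg w)]
      refine mul_le_mul ?_ (hM w) (norm_nonneg _) (by positivity)
      have h1 : Real.exp (-(u.re * sqNorm w)) ≤ Real.exp (-(ε * sqNorm w)) :=
        Real.exp_le_exp.2 (neg_le_neg (mul_le_mul_of_nonneg_right (hball u hu) (sqNorm_nonneg w)))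
      have h2 : sqNorm w ≤ 2 / ε * Real.exp (ε / 2 * sqNorm w) := by
        have h3 := Real.add_one_le_exp (ε / 2 * sqNorm w)
        rw [div_mul_eq_mul_div, le_div_iff₀ hε0]
        linarith
      calc Real.exp (-(u.re * sqNorm w)) * sqNorm w
          ≤ Real.exp (-(ε * sqNorm w)) * (2 / ε * Real.exp (ε / 2 * sqNorm w)) :=
            mul_le_mul h1 h2 (sqNorm_nonneg w) (Real.exp_pos _).le
        _ = 2 / ε * (Real.exp (-(ε * sqNorm w)) * Real.exp (ε / 2 * sqNorm w)) := by ring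
        _ = 2 / ε * Real.exp (-(ε / 2 * sqNorm w)) := by
            rw [← Real.exp_add]; congr 2; ring)
    (((integrable_exp_neg_mul_sqNorm (by positivity)).const_mul _).mul_const M)
    (Eventually.of_forall fun w u _ => by
      have h1 : HasDerivAt (fun u : ℂ => -(u * ((sqNorm w : ℝ) : ℂ))) (-((sqNorm w : ℝ) : ℂ)) u := by
        simpa using ((hasDerivAt_id u).mul_const ((sqNorm w : ℝ) : ℂ)).fun_neg
      exact h1.cexp.mul_const (ψ w))
  exact key.2.differentiableAt.differentiableWithinAt

theorem laplace_inv_eq {s : ℝ} (hs : 0 < s) (ψ : (Fin n → ℂ) → ℂ) :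
    ∫ w, Complex.exp (-(((s⁻¹ : ℝ) : ℂ) * ((sqNorm w : ℝ) : ℂ))) * ψ w =
      (((Real.pi * s) ^ n : ℝ) : ℂ) * ∫ w, ((gauss n s w : ℝ) : ℂ) * ψ w := by
  rw [← integral_const_mul]
  refine integral_congr_ae (Eventually.of_forall fun w => ?_)
  simp only
  rw [← Complex.ofReal_mul, ← mul_assoc, ← Complex.ofReal_mul, ← exp_eq_gauss hs,
    Complex.ofReal_exp, Complex.ofReal_neg]

/-- The integral `∫ e^{-u|w|²} ψ(w) dw` is holomorphic for `Re u > 0` and is a multiple of `∫ f_r ψ`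
at `u = 1/r`. It vanishes for all widths `r > s`, that is for `0 < u < 1/s`, hence identically;
letting `r → 0` recovers `ψ(0)`. -/
theorem eq_zero_of_integral_gauss_eq_zero {s : ℝ} (hs : 0 < s) {ψ : (Fin n → ℂ) → ℂ}
    (hψ : Continuous ψ) {M : ℝ} (hM : ∀ z, ‖ψ z‖ ≤ M)
    (h : ∀ v, ∫ z, ((gauss n s z : ℝ) : ℂ) * ψ (z + v) = 0) : ψ 0 = 0 := by
  have hopen : IsOpen {u : ℂ | 0 < u.re} := isOpen_lt continuous_const Complex.continuous_re
  have hpos : 0 < s⁻¹ := inv_pos.2 hs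
  have hev : ∀ᶠ x : ℝ in 𝓝 (s⁻¹ / 2),
      ∫ w, Complex.exp (-((x : ℂ) * ((sqNorm w : ℝ) : ℂ))) * ψ w = 0 := by
    filter_upwards [Ioo_mem_nhds (half_pos hpos) (half_lt_self hpos)] with x hx
    have hlt : s < x⁻¹ := by
      rw [lt_inv_comm₀ hs hx.1]; exact hx.2
    have h1 := laplace_inv_eq (inv_pos.2 hx.1) ψ
    have h2 := integral_gauss_add_eq_zero hs hψ hM h (sub_pos.2 hlt)
    rw [sub_add_cancel] at h2
    rw [inv_inv, h2, mul_zero] at h1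
    exact h1
  have hz := ((differentiableOn_laplace hψ hM).analyticOnNhd
    hopen).eqOn_zero_of_preconnected_of_frequently_eq_zero
    (convex_halfSpace_re_gt 0).isPreconnected
    (show ((s⁻¹ / 2 : ℝ) : ℂ) ∈ {u : ℂ | 0 < u.re} from by
      change 0 < ((s⁻¹ / 2 : ℝ) : ℂ).re
      rw [Complex.ofReal_re]; positivity)
    (frequently_ofReal hev)
  have hlim := tendsto_integral_gauss_smul hψ hM
  refine tendsto_nhds_unique hlim (tendsto_const_nhds.congr' ?_)
  filter_upwards [self_mem_nhdsWithin] with r hr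
  have hr : 0 < r := hr
  have h1 := hz (show ((r⁻¹ : ℝ) : ℂ) ∈ {u : ℂ | 0 < u.re} from by
    change 0 < ((r⁻¹ : ℝ) : ℂ).re
    rw [Complex.ofReal_re]; positivity)
  have h2 := (laplace_inv_eq hr ψ).symm.trans h1
  have h3 : (((Real.pi * r) ^ n : ℝ) : ℂ) ≠ 0 := by
    have : (Real.pi * r) ^ n ≠ 0 := by positivity
    exact_mod_cast this
  exact ((mul_eq_zero.1 h2).resolve_left h3).symm

end Gaussian

/-- Hahn–Banach in the quotient by the closed subspace `S`. -/
theorem exists_dual_of_notMem {E : Type*} [NormedAddCommGroup E] [NormedSpace ℂ E]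
    {S : Submodule ℂ E} (hS : IsClosed (S : Set E)) {x : E} (hx : x ∉ S) :
    ∃ ℓ : E →L[ℂ] ℂ, ℓ x ≠ 0 ∧ ∀ y ∈ S, ℓ y = 0 := by
  have hne : ‖S.mkQL x‖ ≠ 0 := by
    rw [norm_ne_zero_iff]
    exact fun h => hx ((Submodule.Quotient.mk_eq_zero S).1 h)
  obtain ⟨g, -, hg⟩ := exists_dual_vector ℂ (S.mkQL x) hne
  refine ⟨g.comp S.mkQL, ?_, fun y hy => ?_⟩
  · rw [ContinuousLinearMap.comp_apply, hg]
    exact RCLike.ofReal_ne_zero.2 hne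
  · have : S.mkQL y = 0 := (Submodule.Quotient.mk_eq_zero S).2 hy
    rw [ContinuousLinearMap.comp_apply, this, map_zero]

section Space

variable {n : ℕ} {p t : ℝ} [hp : Fact (1 < p)] [ht : Fact (0 < t)]

/-! ### Density of Toeplitz operators -/

theorem convOp_eq {f : (Fin n → ℂ) → ℂ} (hf : f ∈ BUC n) {C : BOp n p t} (h : WeakConv f Rop C) :
    convOp Rop f = C :=
  (weakConv_convOp hf).unique h

/-- The subspace of Toeplitz operators with symbols in `BUC(ℂⁿ)`. -/
def toeplitzSubmodule (n : ℕ) (p t : ℝ) [Fact (1 < p)] [Fact (0 < t)] :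
    Submodule ℂ (BOp n p t) where
  carrier := {A | ∃ f ∈ BUC n, A = convOp Rop f}
  add_mem' := by
    rintro A B ⟨f, hf, rfl⟩ ⟨g, hg, rfl⟩
    have hfg : (fun z => f z + g z) ∈ BUC n := by
      obtain ⟨M, hM⟩ := hf.2
      obtain ⟨M', hM'⟩ := hg.2
      exact ⟨hf.1.add hg.1, M + M', fun z => (norm_add_le _ _).trans (add_le_add (hM z) (hM' z))⟩
    exact ⟨_, hfg, (convOp_eq hfg ((weakConv_convOp hf).add (weakConv_convOp hg))).symm⟩
  zero_mem' := by
    refine ⟨fun _ => 0, const_mem_BUC n 0, (convOp_eq (const_mem_BUC n 0) fun y x => ?_).symm⟩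
    simp
  smul_mem' := by
    rintro c A ⟨f, hf, rfl⟩
    have hcf : (fun z => c * f z) ∈ BUC n := by
      obtain ⟨M, hM⟩ := hf.2
      refine ⟨hf.1.const_smul c, ‖c‖ * M, fun z => ?_⟩
      rw [norm_mul]
      exact mul_le_mul_of_nonneg_left (hM z) (norm_nonneg c)
    exact ⟨_, hcf, (convOp_eq hcf ((weakConv_convOp hf).smul c)).symm⟩

theorem shift_mem_C1 {A : BOp n p t} (hA : A ∈ C1 n p t) (v : Fin n → ℂ) :
    shift v A ∈ C1 n p t := by
  have hA' : Continuous fun z => shift z A := hA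
  change Continuous fun z => shift z (shift v A)
  simp only [← shift_add]
  exact hA'.comp (continuous_id.add continuous_const)

theorem C1_eq_closure_toeplitz :
    C1 n p t = closure {A | ∃ f ∈ BUC n, A = convOp Rop f} := by
  refine Set.Subset.antisymm (fun A hA => ?_) (closure_minimal ?_ isClosed_C1)
  · change A ∈ (toeplitzSubmodule n p t).topologicalClosure
    by_contra hnot
    obtain ⟨ℓ, hℓ, hℓ0⟩ := exists_dual_of_notMem
      (toeplitzSubmodule n p t).isClosed_topologicalClosure hnot
    have hA' : Continuous fun z => shift z A := hA
    have h := eq_zero_of_integral_gauss_eq_zero ht.out (ψ := fun w => ℓ (shift w A))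
      (ℓ.continuous.comp hA') (M := ‖ℓ‖ * ‖A‖)
      (fun z => (ℓ.le_opNorm _).trans
        (mul_le_mul_of_nonneg_left (norm_shift_le z A) (norm_nonneg _))) (fun v => by
        -- Since `f_t ∗ α_v(A)` is a Toeplitz operator, `ℓ` kills it; written out, this is `∫ f_t(z)
        -- ψ(z + v) dz = 0`.
        have hv := shift_mem_C1 hA v
        have hmem := hℓ0 _ ((toeplitzSubmodule n p t).le_topologicalClosure
          ⟨_, berezin_mem_BUC hv, convFun_gauss_eq_convOp hv⟩)
        rw [convFun_eq_integral (integrable_gauss_complex n ht.out) hv,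
          ← ℓ.integral_comp_comm (integrable_smul_of_bounded (integrable_gauss_complex n ht.out) hv
            (fun z => norm_shift_le z _))] at hmem
        simpa only [map_smul, smul_eq_mul, ← shift_add] using hmem)
    exact hℓ (by simpa only [shift_zero] using h)
  · rintro A ⟨f, hf, rfl⟩
    exact convOp_mem_C1 hf

end Space

end PFock

end

theorem mainTheorem7 (n : ℕ) (p t : ℝ) [Fact (1 < p)] [Fact (0 < t)] :
    -- the convolutions are well defined
    (∀ g : (Fin n → ℂ) → ℂ, Integrable g volume →
      ∀ B : PFock.FockSpace n p t →L[ℂ] PFock.FockSpace n p t,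
        ∃! C : PFock.FockSpace n p t →L[ℂ] PFock.FockSpace n p t, PFock.IsConvFun g B C) ∧
    (∀ f ∈ PFock.BUC n, ∃! C : PFock.FockSpace n p t →L[ℂ] PFock.FockSpace n p t,
        PFock.IsConvOp PFock.Rop f C) ∧
    -- the four descriptions of `C₁`
    PFock.C1 n p t = closure (Submodule.span ℂ
      {A | ∃ (g : (Fin n → ℂ) → ℂ) (B : PFock.FockSpace n p t →L[ℂ] PFock.FockSpace n p t),
        Integrable g volume ∧ A = PFock.convFun g B} :
        Set (PFock.FockSpace n p t →L[ℂ] PFock.FockSpace n p t)) ∧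
    PFock.C1 n p t = {B | Tendsto (fun s : ℝ => PFock.convFun
      (fun z => ((PFock.gauss n s z : ℝ) : ℂ)) B) (𝓝[>] 0) (𝓝 B)} ∧
    PFock.C1 n p t = closure {A | ∃ f ∈ PFock.BUC n, A = PFock.convOp PFock.Rop f} ∧
    PFock.C1 n p t = {A | ∃ (g : (Fin n → ℂ) → ℂ), Integrable g volume ∧
      ∃ B ∈ PFock.C1 n p t, A = PFock.convFun g B} ∧
    -- `R_t ∗ f` is the Toeplitz operator with symbol `f`
    (∀ f ∈ PFock.BUC n, PFock.IsToeplitz f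
      (PFock.convOp PFock.Rop f : PFock.FockSpace n p t →L[ℂ] PFock.FockSpace n p t)) :=
  ⟨fun _ hg B => PFock.existsUnique_isConvFun hg B, fun _ hf => PFock.existsUnique_isConvOp hf,
    PFock.C1_eq_closure_span, PFock.C1_eq_gauss, PFock.C1_eq_closure_toeplitz, PFock.C1_eq_factor,
    fun _ hf => (PFock.weakConv_convOp hf).isToeplitz⟩
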